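/- Let $p$ be a prime and $X$ a group acting by automorphisms on a nilpotent group $R$ (so $R$ is an $X$-group) that is radicable, i.e. for every $g\in R$ and every nonzero integer $n$ there is $x\in R$ with $x^n=g$. Let $P$ be the torsion subgroup of $R$ (the set of elements of finite order), and assume that $P$ is $p$-minimax: $P$ has a series $1=S_0\unlhd S_1\unlhd\cdots\unlhd S_r=P$ in which each factor $S_{i+1}/S_i$ is finite, infinite cyclic, or isomorphic to $\mathbb Z(q^\infty)=\mathbb Z[1/q]/\mathbb Z$ for some prime $q$, and no quotient of a subgroup of $P$ is isomorphic to $\mathbb Z(q^\infty)$ for a prime $q\neq p$. Then there exist a nilpotent radicable $X$-group $\bar R$ and an $X$-equivariant epimorphism $\psi:\bar R\to R$ such that there is an $X$-equivariant group isomorphism $\nu:P\to\psi^{-1}(P)$ with $\psi(\nu(u))=u^p$ for all $u\in P$. Furthermore, for every $\bar R$ and $\psi$ with these properties, the abelianizations satisfy $\mathrm{Ann}_{\mathbb ZX}(\bar R_{\mathrm{ab}})=\mathrm{Ann}_{\mathbb ZX}(R_{\mathrm{ab}})$. -/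

import Mathlib

universe u v

/-- A group is radicable if every element has an `n`-th root for every nonzero integer `n`. -/
def IsRadicable (G : Type*) [Group G] : Prop :=
  ∀ n : ℤ, n ≠ 0 → ∀ g : G, ∃ x : G, x ^ n = g

/-- The quasicyclic group `ℤ(p^∞) = ℤ[1/p] / ℤ`, written additively. -/
abbrev QuasicyclicGroup (p : ℕ) : Type :=
  Localization.Away (p : ℤ) ⧸ (Int.castAddHom (Localization.Away (p : ℤ))).range

/-- The group `G` is isomorphic to `ℤ(p^∞)`. -/
def IsQuasicyclic (p : ℕ) (G : Type*) [Group G] : Prop :=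
  Nonempty (G ≃* Multiplicative (QuasicyclicGroup p))

/-- A factor of a minimax series: finite, infinite cyclic, or quasicyclic (for some prime). -/
def IsMinimaxFactor (G : Type*) [Group G] : Prop :=
  Finite G ∨ (IsCyclic G ∧ Infinite G) ∨ ∃ q : ℕ, q.Prime ∧ IsQuasicyclic q G

/-- Virtually solvable minimax groups: there is a series `1 = S 0 ⊴ S 1 ⊴ ⋯ ⊴ S r = G` each of
whose factors is finite, infinite cyclic, or quasicyclic. -/
def IsMinimaxGroup (G : Type*) [Group G] : Prop :=
  ∃ (r : ℕ) (S : ℕ → Subgroup G), S 0 = ⊥ ∧ S r = ⊤ ∧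
    ∀ i < r, S i ≤ S (i + 1) ∧
      ∃ _ : ((S i).subgroupOf (S (i + 1))).Normal,
        IsMinimaxFactor (↥(S (i + 1)) ⧸ (S i).subgroupOf (S (i + 1)))

/-- The spectrum of `G`: the primes `q` such that some section of `G` is isomorphic to
`ℤ(q^∞)`. -/
def groupSpectrum (G : Type*) [Group G] : Set ℕ :=
  {q | q.Prime ∧ ∃ (H : Subgroup G) (K : Subgroup H) (_ : K.Normal), IsQuasicyclic q (H ⧸ K)}

/-- `π`-minimax groups: minimax groups whose spectrum is contained in the set of primes `π`. -/
def IsPiMinimax (π : Set ℕ) (G : Type*) [Group G] : Prop :=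
  IsMinimaxGroup G ∧ groupSpectrum G ⊆ π

section

open scoped commutatorElement

/-- Modulo the next term, the elements of a term of the lower central series are central. -/
theorem commute_mk_lowerCentralSeries {G : Type*} [Group G] (n : ℕ) {g : G}
    (hg : g ∈ (⊤ : Subgroup G).lowerCentralSeries n) (h : G) :
    Commute (g : G ⧸ (⊤ : Subgroup G).lowerCentralSeries (n + 1)) h := by
  have h1 : ⁅g, h⁆ ∈ (⊤ : Subgroup G).lowerCentralSeries (n + 1) :=
    Subgroup.commutator_mem_commutator hg (Subgroup.mem_top h)
  have h2 := (QuotientGroup.eq_one_iff (N := (⊤ : Subgroup G).lowerCentralSeries (n + 1)) _).2 h1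
  rw [← commutatorElement_eq_one_iff_commute]
  exact h2

/-- If `G` is generated by elements of finite order, then each term of its lower central series
is torsion modulo the next one. -/
theorem isOfFinOrder_mk_lowerCentralSeries {G : Type*} [Group G]
    (hG : Subgroup.closure {x : G | IsOfFinOrder x} = ⊤) (n : ℕ) :
    ∀ g ∈ (⊤ : Subgroup G).lowerCentralSeries n,
      IsOfFinOrder (g : G ⧸ (⊤ : Subgroup G).lowerCentralSeries (n + 1)) := by
  induction n with
  | zero =>
    intro g _
    have hg : g ∈ Subgroup.closure {x : G | IsOfFinOrder x} := hG ▸ Subgroup.mem_top g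
    induction hg using Subgroup.closure_induction with
    | mem x hx => exact (QuotientGroup.mk' _).isOfFinOrder hx
    | one => exact IsOfFinOrder.one
    | mul x y _ _ hx hy =>
      exact (commute_mk_lowerCentralSeries 0 (Subgroup.mem_top x) y).isOfFinOrder_mul
        (hx (Subgroup.mem_top x)) (hy (Subgroup.mem_top y))
    | inv x _ hx => exact (hx (Subgroup.mem_top x)).inv
  | succ n ih =>
    intro g hg
    have hg' : g ∈ Subgroup.closure
        {x | ∃ p ∈ (⊤ : Subgroup G).lowerCentralSeries n, ∃ q ∈ (⊤ : Subgroup G), ⁅p, q⁆ = x} := hg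
    clear hg
    suffices H : g ∈ (⊤ : Subgroup G).lowerCentralSeries (n + 1) ∧
        IsOfFinOrder (g : G ⧸ (⊤ : Subgroup G).lowerCentralSeries (n + 1 + 1)) from H.2
    induction hg' using Subgroup.closure_induction with
    | mem x hx =>
      obtain ⟨a, ha, b, hb, rfl⟩ := hx
      have hc : ⁅a, b⁆ ∈ (⊤ : Subgroup G).lowerCentralSeries (n + 1) :=
        Subgroup.commutator_mem_commutator ha hb
      refine ⟨hc, ?_⟩
      obtain ⟨k, hk, hak⟩ := isOfFinOrder_iff_pow_eq_one.1 (ih a ha)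
      refine isOfFinOrder_iff_pow_eq_one.2 ⟨k, hk, ?_⟩
      have hak' : a ^ k ∈ (⊤ : Subgroup G).lowerCentralSeries (n + 1) :=
        (QuotientGroup.eq_one_iff _).1 ((QuotientGroup.mk_pow _ a k).trans hak)
      have hcomm := commute_mk_lowerCentralSeries (n + 1) hak' b
      have hcen := commute_mk_lowerCentralSeries (n + 1) hc a
      have hconj : ((b * a * b⁻¹ : G) : G ⧸ (⊤ : Subgroup G).lowerCentralSeries (n + 1 + 1)) =
          ((⁅a, b⁆⁻¹ : G) : G ⧸ (⊤ : Subgroup G).lowerCentralSeries (n + 1 + 1)) * a := by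
        have : b * a * b⁻¹ = ⁅a, b⁆⁻¹ * a := by rw [commutatorElement_def]; group
        rw [this]; rfl
      have hpow := congrArg (· ^ k) hconj
      have hcen' : Commute
          ((⁅a, b⁆⁻¹ : G) : G ⧸ (⊤ : Subgroup G).lowerCentralSeries (n + 1 + 1)) a :=
        hcen.inv_left
      simp only [hcen'.mul_pow] at hpow
      rw [QuotientGroup.mk_mul, QuotientGroup.mk_mul, QuotientGroup.mk_inv, conj_pow,
        ← QuotientGroup.mk_pow, ← hcomm.eq, mul_inv_cancel_right, QuotientGroup.mk_inv,
        inv_pow] at hpow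
      exact inv_eq_one.1 (right_eq_mul.1 hpow)
    | one => exact ⟨Subgroup.one_mem _, IsOfFinOrder.one⟩
    | mul x y _ _ hx hy =>
      exact ⟨Subgroup.mul_mem _ hx.1 hy.1,
        (commute_mk_lowerCentralSeries (n + 1) hx.1 y).isOfFinOrder_mul hx.2 hy.2⟩
    | inv x _ hx => exact ⟨Subgroup.inv_mem _ hx.1, hx.2.inv⟩

end

/-- A nilpotent group generated by elements of finite order is a torsion group. -/
theorem isOfFinOrder_of_closure_eq_top {G : Type*} [Group G] [hN : Group.IsNilpotent G]
    (hG : Subgroup.closure {x : G | IsOfFinOrder x} = ⊤) (g : G) : IsOfFinOrder g := by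
  have key : ∀ n : ℕ, ∃ k : ℕ, 0 < k ∧ g ^ k ∈ (⊤ : Subgroup G).lowerCentralSeries n := by
    intro n
    induction n with
    | zero => exact ⟨1, one_pos, Subgroup.mem_top _⟩
    | succ n ih =>
      obtain ⟨k, hk, hgk⟩ := ih
      obtain ⟨m, hm, hgm⟩ :=
        isOfFinOrder_iff_pow_eq_one.1 (isOfFinOrder_mk_lowerCentralSeries hG n _ hgk)
      refine ⟨k * m, Nat.mul_pos hk hm, (QuotientGroup.eq_one_iff _).1 ?_⟩
      rw [pow_mul]
      exact (QuotientGroup.mk_pow _ (g ^ k) m).trans hgm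
  obtain ⟨n, hn⟩ := Subgroup.nilpotent_iff_lowerCentralSeries.1 hN
  obtain ⟨k, hk, hgk⟩ := key n
  rw [hn, Subgroup.mem_bot] at hgk
  exact isOfFinOrder_iff_pow_eq_one.2 ⟨k, hk, hgk⟩

/-- In a nilpotent group the product of two elements of finite order has finite order. -/
theorem isOfFinOrder_mul_of_isNilpotent {G : Type*} [Group G] [Group.IsNilpotent G] {x y : G}
    (hx : IsOfFinOrder x) (hy : IsOfFinOrder y) : IsOfFinOrder (x * y) := by
  let T : Subgroup G := Subgroup.closure {x : G | IsOfFinOrder x}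
  have hT : Subgroup.closure {x : T | IsOfFinOrder x} = ⊤ := by
    have h := Subgroup.closure_closure_coe_preimage (k := {x : G | IsOfFinOrder x})
    have h2 : {x : T | IsOfFinOrder x} = Subtype.val ⁻¹' {x : G | IsOfFinOrder x} := by
      ext z
      exact Submonoid.isOfFinOrder_coe.symm
    rw [h2]
    exact h
  have hxy : x * y ∈ T :=
    T.mul_mem (Subgroup.subset_closure hx) (Subgroup.subset_closure hy)
  exact Submonoid.isOfFinOrder_coe.2 (isOfFinOrder_of_closure_eq_top hT ⟨x * y, hxy⟩)

/-- The torsion subgroup of a nilpotent group: the subgroup of all elements of finite order. -/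
def nilTorsion (G : Type*) [Group G] [Group.IsNilpotent G] : Subgroup G where
  carrier := {x | IsOfFinOrder x}
  one_mem' := IsOfFinOrder.one
  inv_mem' := fun h => h.inv
  mul_mem' := fun hx hy => isOfFinOrder_mul_of_isNilpotent hx hy

/-- The torsion subgroup is invariant under every group action by automorphisms. -/
theorem smul_mem_nilTorsion {X G : Type*} [Group X] [Group G] [Group.IsNilpotent G]
    [MulDistribMulAction X G] (x : X) {u : G} (hu : u ∈ nilTorsion G) :
    x • u ∈ nilTorsion G :=
  (MulDistribMulAction.toMonoidHom G x).isOfFinOrder hu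

/-- The action of `X` on the abelianization of an `X`-group `G`, as a representation over `ℤ`. -/
def abelianizationRep (X G : Type*) [Group X] [Group G] [MulDistribMulAction X G] :
    Representation ℤ X (Additive (Abelianization G)) where
  toFun x := (MonoidHom.toAdditive
    (Abelianization.map (MulDistribMulAction.toMonoidHom G x))).toIntLinearMap
  map_one' := by
    ext g
    induction g using QuotientGroup.induction_on with
    | H z => exact congrArg (fun t : G => Additive.ofMul (Abelianization.of t)) (one_smul X z)
  map_mul' x y := by
    ext g
    induction g using QuotientGroup.induction_on with
    | H z => exact congrArg (fun t : G => Additive.ofMul (Abelianization.of t)) (mul_smul x y z)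

/-- The annihilator in the group ring `ℤX` of the `ℤX`-module `G_ab`. -/
noncomputable def abAnnihilator (X G : Type*) [Group X] [Group G] [MulDistribMulAction X G] :
    Ideal (MonoidAlgebra ℤ X) :=
  Module.annihilator (MonoidAlgebra ℤ X) (abelianizationRep X G).asModule

/-- `Rbar` is a radicable nilpotent `X`-group and `ψ : Rbar → R` is an epimorphism of `X`-groups
such that, for the torsion subgroup `P` of `R`, there is an isomorphism of `X`-groups
`ν : P → ψ⁻¹(P)` with `ψ (ν u) = u ^ p` for all `u ∈ P`. -/
structure IsPowerCover (X : Type*) [Group X] (p : ℕ)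
    {R : Type*} [Group R] [Group.IsNilpotent R] [MulDistribMulAction X R]
    {Rbar : Type*} [Group Rbar] [MulDistribMulAction X Rbar] (ψ : Rbar →* R) : Prop where
  nilpotent : Group.IsNilpotent Rbar
  radicable : IsRadicable Rbar
  surjective : Function.Surjective ψ
  equivariant : ∀ (x : X) (r : Rbar), ψ (x • r) = x • ψ r
  exists_iso : ∃ ν : nilTorsion R ≃* (nilTorsion R).comap ψ,
    (∀ (x : X) (u : nilTorsion R),
      (ν ⟨x • (u : R), smul_mem_nilTorsion x u.2⟩ : Rbar) = x • (ν u : Rbar)) ∧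
    ∀ u : nilTorsion R, ψ (ν u : Rbar) = (u : R) ^ p

/-! Write `P` for the torsion subgroup of `R` and index the lower central series `γ` from `γ 0`, the
whole group. Let `F` be the free product of copies of `ℚ`, one for each homomorphism `ℚ → R`. Since
`R` is radicable, the evident map `φ : F → R` is onto, and `X` acts on `F` by permuting the factors.
Let `S = φ⁻¹(P)`, `K = ker φ` and `M = [S, F]`. As `P` is central in `R` (`nilTorsion_le_center`),
`M ≤ K`; also `S / M` is central in `F / M`. The cover is `F / N`, where `N / M` consists of the
`p`-th powers from `K / M`. The map `ν` lifts `u` to `s ∈ S` and takes the class of `s ^ p`. It is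
an isomorphism onto `S / N` because `S / M` is uniquely `p`-divisible
(`exists_isPowerCover_quotient`).

Existence of `p`-th roots follows from divisibility of the factors `ℚ`, corrected step by step along
the lower central series. Uniqueness reduces to torsion-freeness of the lower central factors of
`F`. This comes from a Dynkin operator argument. A nilpotent quotient `G` of `F` gives unipotent
operators on a graded `ℚ`-space built from the graded Lie ring of `G`, by exponentiating operators
of degree one. An element of `γ m` acts as the identity plus a leading term, which takes a base
vector of degree zero to `m + 1` times the class of the element. Over `ℚ` this leading term vanishes
as soon as a multiple of it does, so torsion in the factor is killed by `m + 1`; since the factor is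
also divisible, it has no torsion at all.

For the annihilators, the kernel of the surjection from the abelianization of the cover to that of
`R` is killed by `p`, while the former is `p`-divisible. These two facts let annihilation lift from
`R` to the cover. -/

open scoped commutatorElement

/-! ### Commutators of terms of the lower central series -/

namespace Subgroup

variable {G : Type*} [Group G]

/-- The three subgroups lemma modulo a normal subgroup. -/
theorem commutator_commutator_le_of_rotate {H₁ H₂ H₃ N : Subgroup G} [N.Normal]
    (h1 : ⁅⁅H₂, H₃⁆, H₁⁆ ≤ N) (h2 : ⁅⁅H₃, H₁⁆, H₂⁆ ≤ N) : ⁅⁅H₁, H₂⁆, H₃⁆ ≤ N := by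
  have key : ∀ K : Subgroup G, K.map (QuotientGroup.mk' N) = ⊥ ↔ K ≤ N := by
    intro K
    rw [Subgroup.map_eq_bot_iff, QuotientGroup.ker_mk']
  rw [← key, map_commutator, map_commutator] at h1 h2 ⊢
  exact commutator_commutator_eq_bot_of_rotate h1 h2

/-- Induction on `j`: the three subgroups lemma trades the last commutation with the whole group for
one that raises `i`. -/
theorem commutator_lowerCentralSeries_le (i j : ℕ) :
    ⁅(⊤ : Subgroup G).lowerCentralSeries i, (⊤ : Subgroup G).lowerCentralSeries j⁆ ≤
      (⊤ : Subgroup G).lowerCentralSeries (i + j + 1) := by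
  induction j generalizing i with
  | zero => exact le_rfl
  | succ j ih =>
    rw [commutator_comm, lowerCentralSeries_succ _ j]
    refine commutator_commutator_le_of_rotate ?_ ?_
    · rw [commutator_comm ⊤, ← lowerCentralSeries_succ]
      exact (ih (i + 1)).trans (le_of_eq (by congr 1; omega))
    · refine (commutator_mono (ih i) le_rfl).trans (le_of_eq ?_)
      rw [← lowerCentralSeries_succ]
      congr 1

end Subgroup

/-! ### The graded Lie ring of the lower central series -/

section Graded

variable (G : Type*) [Group G]

/-- The `k`-th lower central factor. -/
abbrev LowerCentralFactor (k : ℕ) : Type _ :=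
  ↥((⊤ : Subgroup G).lowerCentralSeries k) ⧸
    ((⊤ : Subgroup G).lowerCentralSeries (k + 1)).subgroupOf
      ((⊤ : Subgroup G).lowerCentralSeries k)

instance (k : ℕ) : CommGroup (LowerCentralFactor G k) :=
  { QuotientGroup.Quotient.group _ with
    mul_comm := by
      intro a b
      induction a using QuotientGroup.induction_on with | H a => ?_
      induction b using QuotientGroup.induction_on with | H b => ?_
      refine QuotientGroup.eq.2 ?_
      rw [Subgroup.mem_subgroupOf]
      have h : ⁅(b : G)⁻¹, (a : G)⁻¹⁆ ∈ (⊤ : Subgroup G).lowerCentralSeries (k + 1) :=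
        Subgroup.commutator_mem_commutator (inv_mem b.2) (Subgroup.mem_top _)
      simpa [commutatorElement_def, mul_assoc] using h }

/-- The additive group of the `k`-th lower central factor. -/
def GrLCS (k : ℕ) : Type _ := Additive (LowerCentralFactor G k)

noncomputable instance (k : ℕ) : AddCommGroup (GrLCS G k) :=
  inferInstanceAs (AddCommGroup (Additive (LowerCentralFactor G k)))

namespace GrLCS

variable {G}

/-- The class of an element of the `k`-th term of the lower central series. -/
def cls (k : ℕ) (x : G) (hx : x ∈ (⊤ : Subgroup G).lowerCentralSeries k) : GrLCS G k :=
  Additive.ofMul (QuotientGroup.mk ⟨x, hx⟩ : LowerCentralFactor G k)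

theorem cls_surjective {k : ℕ} (a : GrLCS G k) : ∃ x hx, cls k x hx = a := by
  obtain ⟨⟨x, hx⟩, h⟩ := QuotientGroup.mk_surjective (Additive.toMul a : LowerCentralFactor G k)
  exact ⟨x, hx, h⟩

theorem cls_mul {k : ℕ} {x y : G} (hx : x ∈ (⊤ : Subgroup G).lowerCentralSeries k)
    (hy : y ∈ (⊤ : Subgroup G).lowerCentralSeries k) :
    cls k (x * y) (mul_mem hx hy) = cls k x hx + cls k y hy := rfl

theorem cls_eq_zero_iff {k : ℕ} {x : G} (hx : x ∈ (⊤ : Subgroup G).lowerCentralSeries k) :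
    cls k x hx = 0 ↔ x ∈ (⊤ : Subgroup G).lowerCentralSeries (k + 1) :=
  QuotientGroup.eq_one_iff (N := ((⊤ : Subgroup G).lowerCentralSeries (k + 1)).subgroupOf
      ((⊤ : Subgroup G).lowerCentralSeries k)) _

theorem mem_zero (x : G) : x ∈ (⊤ : Subgroup G).lowerCentralSeries 0 := Subgroup.mem_top x

theorem cls_one {k : ℕ} : cls k (1 : G) (one_mem _) = 0 := rfl

theorem cls_inv {k : ℕ} {x : G} (hx : x ∈ (⊤ : Subgroup G).lowerCentralSeries k) :
    cls k x⁻¹ (inv_mem hx) = - cls k x hx := rfl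

theorem cls_pow {k : ℕ} {x : G} (hx : x ∈ (⊤ : Subgroup G).lowerCentralSeries k) (n : ℕ) :
    cls k (x ^ n) (pow_mem hx n) = n • cls k x hx := rfl

theorem cls_eq_cls_iff {k : ℕ} {x y : G} (hx : x ∈ (⊤ : Subgroup G).lowerCentralSeries k)
    (hy : y ∈ (⊤ : Subgroup G).lowerCentralSeries k) :
    cls k x hx = cls k y hy ↔ x * y⁻¹ ∈ (⊤ : Subgroup G).lowerCentralSeries (k + 1) := by
  rw [← sub_eq_zero, sub_eq_add_neg, ← cls_inv, ← cls_mul, cls_eq_zero_iff]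

theorem cls_conj {k : ℕ} {x : G} (hx : x ∈ (⊤ : Subgroup G).lowerCentralSeries k) (g : G) :
    cls k (g * x * g⁻¹) (Subgroup.Normal.conj_mem inferInstance x hx g) = cls k x hx := by
  rw [cls_eq_cls_iff]
  have h : ⁅x, g⁆⁻¹ ∈ (⊤ : Subgroup G).lowerCentralSeries (k + 1) :=
    inv_mem (Subgroup.commutator_mem_commutator hx (Subgroup.mem_top _))
  rwa [commutatorElement_inv, commutatorElement_def] at h

theorem commutator_mem {i j k : ℕ} (h : k = i + j + 1) {x y : G}
    (hx : x ∈ (⊤ : Subgroup G).lowerCentralSeries i)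
    (hy : y ∈ (⊤ : Subgroup G).lowerCentralSeries j) :
    ⁅x, y⁆ ∈ (⊤ : Subgroup G).lowerCentralSeries k := by
  rw [h]
  exact Subgroup.commutator_lowerCentralSeries_le i j (Subgroup.commutator_mem_commutator hx hy)

theorem cls_commutator_mul_right {i j k : ℕ} (h : k = i + j + 1) {x y z : G}
    (hx : x ∈ (⊤ : Subgroup G).lowerCentralSeries i)
    (hy : y ∈ (⊤ : Subgroup G).lowerCentralSeries j)
    (hz : z ∈ (⊤ : Subgroup G).lowerCentralSeries j) :
    cls k ⁅x, y * z⁆ (commutator_mem h hx (mul_mem hy hz)) =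
      cls k ⁅x, y⁆ (commutator_mem h hx hy) + cls k ⁅x, z⁆ (commutator_mem h hx hz) := by
  rw [← cls_conj (commutator_mem h hx hz) y, ← cls_mul]
  congr 1
  rw [commutatorElement_mul_right_eq_mul_conj]
  group

theorem cls_commutator_swap {i j k : ℕ} (h : k = i + j + 1) {x y : G}
    (hx : x ∈ (⊤ : Subgroup G).lowerCentralSeries i)
    (hy : y ∈ (⊤ : Subgroup G).lowerCentralSeries j) :
    cls k ⁅x, y⁆ (commutator_mem h hx hy) =
      - cls k ⁅y, x⁆ (commutator_mem (by omega) hy hx) := by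
  rw [← cls_inv]
  congr 1
  exact (commutatorElement_inv y x).symm

theorem cls_commutator_mul_left {i j k : ℕ} (h : k = i + j + 1) {x y z : G}
    (hx : x ∈ (⊤ : Subgroup G).lowerCentralSeries i)
    (hy : y ∈ (⊤ : Subgroup G).lowerCentralSeries i)
    (hz : z ∈ (⊤ : Subgroup G).lowerCentralSeries j) :
    cls k ⁅x * y, z⁆ (commutator_mem h (mul_mem hx hy) hz) =
      cls k ⁅x, z⁆ (commutator_mem h hx hz) + cls k ⁅y, z⁆ (commutator_mem h hy hz) := by
  rw [cls_commutator_swap h (mul_mem hx hy) hz, cls_commutator_mul_right (by omega) hz hx hy,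
    cls_commutator_swap h hx hz, cls_commutator_swap h hy hz, neg_add]

/-- The commutator class does not depend on representatives: changing an entry by an element one
term deeper multiplies the commutator by one that is also a term deeper. Additivity can then be
checked on arbitrary representatives. -/
theorem exists_bracket (i j k : ℕ) (h : k = i + j + 1) :
    ∃ f : GrLCS G i →+ GrLCS G j →+ GrLCS G k,
      ∀ (x y : G) (hx : x ∈ (⊤ : Subgroup G).lowerCentralSeries i)
        (hy : y ∈ (⊤ : Subgroup G).lowerCentralSeries j),
        f (cls i x hx) (cls j y hy) = cls k ⁅x, y⁆ (commutator_mem h hx hy) := by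
  choose r hr hcls using fun (m : ℕ) (a : GrLCS G m) => cls_surjective a
  have hdiff : ∀ {m : ℕ} {x : G} (hx : x ∈ (⊤ : Subgroup G).lowerCentralSeries m),
      ∃ z ∈ (⊤ : Subgroup G).lowerCentralSeries (m + 1), r m (cls m x hx) = z * x := by
    intro m x hx
    exact ⟨_, (cls_eq_cls_iff (hr _ _) hx).1 (hcls _ _), by group⟩
  have hr' : ∀ (x y : G) (hx : x ∈ (⊤ : Subgroup G).lowerCentralSeries i)
      (hy : y ∈ (⊤ : Subgroup G).lowerCentralSeries j),
      cls k ⁅r i (cls i x hx), r j (cls j y hy)⁆ (commutator_mem h (hr _ _) (hr _ _)) =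
        cls k ⁅x, y⁆ (commutator_mem h hx hy) := by
    intro x y hx hy
    obtain ⟨z, hz, hzx⟩ := hdiff hx
    obtain ⟨w, hw, hwy⟩ := hdiff hy
    have hz' := Subgroup.lowerCentralSeries_antitone _ (Nat.le_succ i) hz
    have hw' := Subgroup.lowerCentralSeries_antitone _ (Nat.le_succ j) hw
    simp only [hzx, hwy]
    have hy' := mul_mem hw' hy
    rw [cls_commutator_mul_left h hz' hx hy', cls_commutator_mul_right h hx hw' hy,
      (cls_eq_zero_iff _).2 (commutator_mem (by omega) hz hy'),
      (cls_eq_zero_iff _).2 (commutator_mem (by omega) hx hw), zero_add, zero_add]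
  refine ⟨AddMonoidHom.mk' (fun a => AddMonoidHom.mk'
    (fun b => cls k ⁅r i a, r j b⁆ (commutator_mem h (hr _ _) (hr _ _))) ?_) ?_, hr'⟩
  · intro b c
    obtain ⟨y, hy, rfl⟩ := cls_surjective b
    obtain ⟨z, hz, rfl⟩ := cls_surjective c
    obtain ⟨x, hx, rfl⟩ := cls_surjective a
    rw [← cls_mul hy hz, hr', hr', hr', cls_commutator_mul_right h hx hy hz]
  · intro b c
    ext a
    obtain ⟨y, hy, rfl⟩ := cls_surjective b
    obtain ⟨z, hz, rfl⟩ := cls_surjective c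
    obtain ⟨x, hx, rfl⟩ := cls_surjective a
    simp only [AddMonoidHom.mk'_apply, AddMonoidHom.add_apply]
    rw [← cls_mul hy hz, hr', hr', hr', cls_commutator_mul_left h hy hz hx]

/-- The Lie bracket between lower central factors induced by the group commutator. -/
noncomputable def bracket (i j k : ℕ) (h : k = i + j + 1) :
    GrLCS G i →+ GrLCS G j →+ GrLCS G k :=
  (exists_bracket i j k h).choose

theorem bracket_cls {i j k : ℕ} (h : k = i + j + 1) {x y : G}
    (hx : x ∈ (⊤ : Subgroup G).lowerCentralSeries i)
    (hy : y ∈ (⊤ : Subgroup G).lowerCentralSeries j) :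
    bracket i j k h (cls i x hx) (cls j y hy) = cls k ⁅x, y⁆ (commutator_mem h hx hy) :=
  (exists_bracket i j k h).choose_spec x y hx hy

theorem bracket_swap {i j k : ℕ} (h : k = i + j + 1) (h' : k = j + i + 1)
    (a : GrLCS G i) (b : GrLCS G j) : bracket i j k h a b = - bracket j i k h' b a := by
  obtain ⟨x, hx, rfl⟩ := cls_surjective a
  obtain ⟨y, hy, rfl⟩ := cls_surjective b
  rw [bracket_cls, bracket_cls, cls_commutator_swap h hx hy]

/-- The Jacobi identity for the bracket between lower central factors. -/
theorem bracket_bracket {i j l m n o k : ℕ} (hij : m = i + j + 1) (hjl : n = j + l + 1)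
    (hil : o = i + l + 1) (hm : k = m + l + 1) (hn : k = i + n + 1) (ho : k = j + o + 1)
    (a : GrLCS G i) (b : GrLCS G j) (c : GrLCS G l) :
    bracket m l k hm (bracket i j m hij a b) c =
      bracket i n k hn a (bracket j l n hjl b c) - bracket j o k ho b (bracket i l o hil a c) := by
  obtain ⟨x, hx, rfl⟩ := cls_surjective a
  obtain ⟨y, hy, rfl⟩ := cls_surjective b
  obtain ⟨z, hz, rfl⟩ := cls_surjective c
  rw [bracket_swap hn (by omega), bracket_swap ho (by omega), bracket_swap hil (by omega), map_neg,
    AddMonoidHom.neg_apply]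
  have hxy := commutator_mem hij hx hy
  have hyz := commutator_mem hjl hy hz
  have hzx := commutator_mem (show o = l + i + 1 by omega) hz hx
  have hz' : y * z * y⁻¹ ∈ (⊤ : Subgroup G).lowerCentralSeries l :=
    Subgroup.Normal.conj_mem inferInstance z hz y
  have hx' : z * x * z⁻¹ ∈ (⊤ : Subgroup G).lowerCentralSeries i :=
    Subgroup.Normal.conj_mem inferInstance x hx z
  have hy' : x * y * x⁻¹ ∈ (⊤ : Subgroup G).lowerCentralSeries j :=
    Subgroup.Normal.conj_mem inferInstance y hy x
  have h1 := commutator_mem hm hxy hz'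
  have h2 := commutator_mem (show k = n + i + 1 by omega) hyz hx'
  have h3 := commutator_mem (show k = o + j + 1 by omega) hzx hy'
  -- This is the Hall–Witt identity. The conjugations in its inner entries disappear on passing to
  -- classes, by `cls_conj`.
  have key : cls k _ h1 + cls k _ h2 + cls k _ h3 = 0 := by
    rw [← cls_mul, ← cls_mul, ← cls_one]
    congr 1
    exact commutatorElement_commutatorElement_conj_mul x y z
  rw [← bracket_cls hm hxy hz', ← bracket_cls (show k = n + i + 1 by omega) hyz hx',
    ← bracket_cls (show k = o + j + 1 by omega) hzx hy', ← bracket_cls hij hx hy,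
    ← bracket_cls hjl hy hz, ← bracket_cls (show o = l + i + 1 by omega) hz hx, cls_conj hz, cls_conj hx, cls_conj hy] at key
  rw [neg_neg, ← sub_eq_zero, ← key]
  abel

end GrLCS

end Graded

/-! ### The rational vector space of additive maps from `ℚ` -/

section RatHom

/-- Additive maps from `ℚ` to `A`, as a vector space over `ℚ`. -/
def RatHom (A : Type*) [AddCommGroup A] : Type _ := ℚ →+ A

namespace RatHom

variable {A B C : Type*} [AddCommGroup A] [AddCommGroup B] [AddCommGroup C]

noncomputable instance : AddCommGroup (RatHom A) := inferInstanceAs (AddCommGroup (ℚ →+ A))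

instance : FunLike (RatHom A) ℚ A := inferInstanceAs (FunLike (ℚ →+ A) ℚ A)

instance : AddMonoidHomClass (RatHom A) ℚ A := inferInstanceAs (AddMonoidHomClass (ℚ →+ A) ℚ A)

@[ext]
theorem ext {f g : RatHom A} (h : ∀ q, f q = g q) : f = g := DFunLike.ext _ _ h

@[simp]
theorem add_apply (f g : RatHom A) (q : ℚ) : (f + g) q = f q + g q := rfl

@[simp]
theorem neg_apply (f : RatHom A) (q : ℚ) : (-f) q = -f q := rfl

@[simp]
theorem sub_apply (f g : RatHom A) (q : ℚ) : (f - g) q = f q - g q := rfl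

@[simp]
theorem zero_apply (q : ℚ) : (0 : RatHom A) q = 0 := rfl

/-- Scalars act on the source, so torsion in `A` does no harm. Exponentials therefore make sense
before the lower central factors are known to be torsion-free. -/
noncomputable instance : Module ℚ (RatHom A) where
  smul r f := AddMonoidHom.comp (show ℚ →+ A from f) (AddMonoidHom.mulRight r)
  one_smul f := ext fun q => congrArg f (mul_one q)
  mul_smul r s f := ext fun q => congrArg f (show q * (r * s) = q * r * s by ring)
  smul_zero _ := rfl
  smul_add _ _ _ := rfl
  add_smul r s f := ext fun q => (congrArg f (mul_add q r s)).trans (map_add f _ _)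
  zero_smul f := ext fun q => (congrArg f (mul_zero q)).trans (map_zero f)

@[simp]
theorem smul_apply (r : ℚ) (f : RatHom A) (q : ℚ) : (r • f) q = f (q * r) := rfl

/-- Postcomposition with an additive map. -/
noncomputable def map (φ : A →+ B) : RatHom A →ₗ[ℚ] RatHom B where
  toFun f := AddMonoidHom.comp φ (show ℚ →+ A from f)
  map_add' f g := ext fun q => map_add φ (f q) (g q)
  map_smul' _ _ := rfl

@[simp]
theorem map_apply (φ : A →+ B) (f : RatHom A) (q : ℚ) : map φ f q = φ (f q) := rfl

/-- With `q = a / d`, move `d` across the biadditive map: both sides equal `a` times `b (f 1) (g (r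
/ d))`. -/
theorem balanced (b : A →+ B →+ C) (f : RatHom A) (g : RatHom B) (q r : ℚ) :
    b (f q) (g r) = b (f 1) (g (r * q)) := by
  have hd : (q.den : ℚ) ≠ 0 := by exact_mod_cast q.den_nz
  have hr : r = q.den • (r / q.den) := by rw [nsmul_eq_mul]; field_simp
  have h1 : q.den • q = q.num • (1 : ℚ) := by
    rw [nsmul_eq_mul, zsmul_eq_mul, mul_one, mul_comm, Rat.mul_den_eq_num]
  have h2 : r * q = q.num • (r / q.den) := by
    conv_lhs => rw [← Rat.num_div_den q]
    rw [zsmul_eq_mul]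
    field_simp
  rw [h2, map_zsmul, map_zsmul, ← AddMonoidHom.zsmul_apply, ← map_zsmul, ← map_zsmul, ← h1,
    map_nsmul, map_nsmul, AddMonoidHom.nsmul_apply, ← map_nsmul, ← map_nsmul, ← hr]

end RatHom

end RatHom

/-! ### Dynkin's operator and torsion in lower central factors -/

section Dynkin

variable {G : Type*} [Group G]

variable (G) in
/-- The graded `ℚ`-vector space with a line in degree zero, followed by the additive maps from `ℚ`
to the lower central factors. -/
abbrev DynkinSpace : Type _ := ℚ × (∀ k, RatHom (GrLCS G k))

namespace DynkinSpace

/-- The vectors that vanish in degrees less than `k`. -/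
def filtration (k : ℕ) : Submodule ℚ (DynkinSpace G) where
  carrier := {v | (0 < k → v.1 = 0) ∧ ∀ i, i + 1 < k → v.2 i = 0}
  add_mem' := by
    rintro v w ⟨h1, h2⟩ ⟨h3, h4⟩
    exact ⟨fun h => by simp [h1 h, h3 h], fun i h => by simp [h2 i h, h4 i h]⟩
  zero_mem' := ⟨fun _ => rfl, fun _ _ => rfl⟩
  smul_mem' := by
    rintro r v ⟨h1, h2⟩
    exact ⟨fun h => by simp [h1 h], fun i h => by simp [h2 i h]⟩

theorem filtration_antitone : Antitone (filtration (G := G)) :=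
  fun _ _ h _ hv => ⟨fun hk => hv.1 (hk.trans_le h), fun i hi => hv.2 i (hi.trans_le h)⟩

theorem mem_filtration_zero (v : DynkinSpace G) : v ∈ filtration 0 :=
  ⟨fun h => absurd h (lt_irrefl _), fun _ h => absurd h (Nat.not_lt_zero _)⟩

/-- Component `i` has degree `i + 1`. The filtration kills degree zero and the components below `n`;
from `n` on the lower central factors are trivial already. -/
theorem eq_zero_of_mem_filtration {n : ℕ} (hn : (⊤ : Subgroup G).lowerCentralSeries n = ⊥)
    {v : DynkinSpace G} (hv : v ∈ filtration (n + 1)) : v = 0 := by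
  refine Prod.ext (hv.1 n.succ_pos) (funext fun i => ?_)
  rcases lt_or_ge i n with h | h
  · exact hv.2 i (Nat.succ_lt_succ h)
  · ext q
    obtain ⟨x, hx, h'⟩ := GrLCS.cls_surjective (v.2 i q)
    have hx1 : x = 1 := by
      have := Subgroup.lowerCentralSeries_antitone _ h hx
      rwa [hn, Subgroup.mem_bot] at this
    subst hx1
    rw [← h']
    rfl

/-- The class in degree one of a one-parameter subgroup. -/
noncomputable def oneParam (w : Multiplicative ℚ →* G) : RatHom (GrLCS G 0) :=
  AddMonoidHom.mk' (fun q => GrLCS.cls 0 (w (Multiplicative.ofAdd q)) (GrLCS.mem_zero _))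
    fun q r => by
      rw [← GrLCS.cls_mul]
      congr 1
      rw [ofAdd_add, map_mul]

theorem oneParam_apply (w : Multiplicative ℚ →* G) (q : ℚ) :
    oneParam w q = GrLCS.cls 0 (w (Multiplicative.ofAdd q)) (GrLCS.mem_zero _) := rfl

/-- The operator of degree one attached to a one-parameter subgroup. -/
noncomputable def shift (w : Multiplicative ℚ →* G) : Module.End ℚ (DynkinSpace G) where
  toFun v := (0, fun k => match k with
    | 0 => v.1 • oneParam w
    | k + 1 => RatHom.map (GrLCS.bracket 0 k (k + 1) (by omega) (oneParam w 1)) (v.2 k))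
  map_add' v v' := by
    refine Prod.ext (add_zero _).symm (funext fun k => ?_)
    cases k with
    | zero => exact add_smul _ _ _
    | succ k => exact map_add _ _ _
  map_smul' r v := by
    refine Prod.ext (smul_zero _).symm (funext fun k => ?_)
    cases k with
    | zero => exact mul_smul _ _ _
    | succ k => exact map_smul (RatHom.map _) _ _

theorem shift_mem (w : Multiplicative ℚ →* G) {k : ℕ} {v : DynkinSpace G}
    (hv : v ∈ filtration k) : shift w v ∈ filtration (k + 1) := by
  refine ⟨fun _ => rfl, fun i hi => ?_⟩
  cases i with
  | zero =>
    change v.1 • oneParam w = 0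
    rw [hv.1 (by omega), zero_smul]
  | succ i =>
    change RatHom.map _ (v.2 i) = 0
    rw [hv.2 i (by omega), map_zero]

theorem shift_pow_mem (w : Multiplicative ℚ →* G) {k : ℕ} {v : DynkinSpace G}
    (hv : v ∈ filtration k) (j : ℕ) : (shift w ^ j) v ∈ filtration (k + j) := by
  induction j with
  | zero => exact hv
  | succ j ih =>
    rw [pow_succ']
    exact shift_mem w ih

theorem shift_pow_eq_zero {n : ℕ} (hn : (⊤ : Subgroup G).lowerCentralSeries n = ⊥)
    (w : Multiplicative ℚ →* G) : shift w ^ (n + 1) = 0 := by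
  refine LinearMap.ext fun v => ?_
  have := shift_pow_mem w (mem_filtration_zero v) (n + 1)
  rw [zero_add] at this
  exact eq_zero_of_mem_filtration hn this

theorem exp_smul_shift_sub_mem {n : ℕ} (hn : (⊤ : Subgroup G).lowerCentralSeries n = ⊥)
    (w : Multiplicative ℚ →* G) (q : ℚ) {k : ℕ} {v : DynkinSpace G} (hv : v ∈ filtration k) :
    IsNilpotent.exp (q • shift w) v - v - q • shift w v ∈ filtration (k + 2) := by
  -- Exponent `n + 1` would do; the extra `2` lets the constant and linear terms be split off the
  -- sum.
  have h0 : (q • shift w) ^ (n + 1 + 2) = 0 := by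
    rw [smul_pow, pow_add (shift w), shift_pow_eq_zero hn, zero_mul, smul_zero]
  rw [IsNilpotent.exp_eq_sum h0, Finset.sum_range_succ', Finset.sum_range_succ']
  have : ((∑ i ∈ Finset.range (n + 1),
      (((i + 1 + 1).factorial : ℚ)⁻¹ • (q • shift w) ^ (i + 1 + 1))) : Module.End ℚ _) v ∈
      filtration (k + 2) := by
    rw [LinearMap.sum_apply]
    refine Submodule.sum_mem _ fun i _ => ?_
    rw [smul_pow, LinearMap.smul_apply, LinearMap.smul_apply]
    refine Submodule.smul_mem _ _ (Submodule.smul_mem _ _ ?_)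
    exact filtration_antitone (by omega) (shift_pow_mem w hv (i + 1 + 1))
  convert this using 1
  simp only [zero_add, Nat.factorial_one, Nat.cast_one, inv_one, pow_one, one_smul,
    Nat.factorial_zero, pow_zero, LinearMap.add_apply, LinearMap.smul_apply, Module.End.one_apply]
  abel

/-- The one-parameter group of unipotent operators attached to a one-parameter subgroup. -/
noncomputable def expShift {n : ℕ} (hn : (⊤ : Subgroup G).lowerCentralSeries n = ⊥)
    (w : Multiplicative ℚ →* G) : Multiplicative ℚ →* Module.End ℚ (DynkinSpace G) where
  toFun q := IsNilpotent.exp (q.toAdd • shift w)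
  map_one' := by
    rw [toAdd_one, zero_smul, IsNilpotent.exp_zero]
  map_mul' q r := by
    have hnil : ∀ q : ℚ, IsNilpotent (q • shift w) := fun q =>
      ⟨n + 1, by rw [smul_pow, shift_pow_eq_zero hn, smul_zero]⟩
    rw [toAdd_mul, add_smul]
    exact IsNilpotent.exp_add_of_commute
      (((Commute.refl _).smul_left _).smul_right _) (hnil _) (hnil _)

/-- The free product of copies of `ℚ` indexed by `Ω`. -/
abbrev _root_.RatFreeProduct (Ω : Type*) : Type _ :=
  Monoid.CoprodI (fun _ : Ω => Multiplicative ℚ)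

/-- The unipotent representation of the free product of copies of `ℚ`. -/
noncomputable def rep {n : ℕ} (hn : (⊤ : Subgroup G).lowerCentralSeries n = ⊥)
    {Ω : Type*} (w : Ω → Multiplicative ℚ →* G) :
    RatFreeProduct Ω →* Module.End ℚ (DynkinSpace G) :=
  Monoid.CoprodI.lift fun ω => expShift hn (w ω)

/-- The vector spanning degree zero. -/
noncomputable def basePoint : DynkinSpace G := (1, 0)

/-- The operator `T - 1` raises degrees by at least `m + 1`, and its leading term is the adjoint
action of `a` in positive degrees and sends the base point to `m + 1` times `a`. -/
structure HasLeadingTerm (T : Module.End ℚ (DynkinSpace G)) (m : ℕ) (a : GrLCS G m) : Prop where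
  sub_mem : ∀ k, ∀ v ∈ filtration (G := G) k, T v - v ∈ filtration (k + m + 1)
  ad : ∀ i k (hk : k = m + i + 1), ∀ v ∈ filtration (G := G) (i + 1),
    (T v - v).2 k = RatHom.map (GrLCS.bracket m i k hk a) (v.2 i)
  der : (T basePoint - basePoint).2 m 1 = (m + 1) • a

namespace HasLeadingTerm

variable {T U : Module.End ℚ (DynkinSpace G)} {m : ℕ} {a b : GrLCS G m}

theorem one (m : ℕ) : HasLeadingTerm (1 : Module.End ℚ (DynkinSpace G)) m 0 where
  sub_mem k v _ := by simp
  ad i k hk v _ := by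
    ext q
    simp
  der := by simp

theorem mul (hT : HasLeadingTerm T m a) (hU : HasLeadingTerm U m b) :
    HasLeadingTerm (T * U) m (a + b) := by
  -- `TU - 1 = (T - 1)(U - 1) + (T - 1) + (U - 1)`, and the product term lies deeper than the
  -- leading degree.
  have key : ∀ v, (T * U) v - v = (T (U v - v) - (U v - v)) + ((T v - v) + (U v - v)) := by
    intro v
    rw [Module.End.mul_apply, map_sub]
    abel
  have hdeep : ∀ k, ∀ v ∈ filtration (G := G) k,
      T (U v - v) - (U v - v) ∈ filtration (k + m + 2) := fun k v hv =>
    filtration_antitone (by omega) (hT.sub_mem _ _ (hU.sub_mem k v hv))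
  refine ⟨fun k v hv => ?_, fun i k hk v hv => ?_, ?_⟩
  · rw [key]
    exact add_mem (filtration_antitone (by omega) (hdeep k v hv))
      (add_mem (hT.sub_mem k v hv) (hU.sub_mem k v hv))
  · rw [key, Prod.snd_add, Pi.add_apply, (hdeep _ v hv).2 k (by omega), zero_add, Prod.snd_add,
      Pi.add_apply, hT.ad i k hk v hv, hU.ad i k hk v hv]
    ext q
    simp
  · rw [key, Prod.snd_add, Pi.add_apply,
      (hdeep _ _ (mem_filtration_zero basePoint)).2 m (by omega), zero_add, Prod.snd_add,
      Pi.add_apply, RatHom.add_apply, hT.der, hU.der, smul_add]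

theorem of_mul_eq_one (hT : HasLeadingTerm T m a) (hUT : U * T = 1)
    (hU : ∀ k, ∀ v ∈ filtration (G := G) k, U v - v ∈ filtration (k + 1)) :
    HasLeadingTerm U m (-a) := by
  have hUT' : ∀ v, U (T v) = v := fun v => by
    rw [← Module.End.mul_apply, hUT, Module.End.one_apply]
  have key : ∀ v, U v - v = -(T v - v) - (U (T v - v) - (T v - v)) := by
    intro v
    rw [map_sub, hUT']
    abel
  have hdeep : ∀ k, ∀ v ∈ filtration (G := G) k,
      U (T v - v) - (T v - v) ∈ filtration (k + m + 2) := fun k v hv =>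
    hU _ _ (hT.sub_mem k v hv)
  refine ⟨fun k v hv => ?_, fun i k hk v hv => ?_, ?_⟩
  · rw [key]
    exact _root_.sub_mem (neg_mem (hT.sub_mem k v hv)) (filtration_antitone (by omega) (hdeep k v hv))
  · rw [key, Prod.snd_sub, Pi.sub_apply, (hdeep _ v hv).2 k (by omega), sub_zero, Prod.snd_neg,
      Pi.neg_apply, hT.ad i k hk v hv]
    ext q
    simp
  · rw [key, Prod.snd_sub, Pi.sub_apply,
      (hdeep _ _ (mem_filtration_zero basePoint)).2 m (by omega), sub_zero, Prod.snd_neg,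
      Pi.neg_apply, RatHom.neg_apply, hT.der, smul_neg]

theorem commutator {c : GrLCS G 0} (hT : HasLeadingTerm T m a) (hU : HasLeadingTerm U 0 c)
    {V W : Module.End ℚ (DynkinSpace G)} (hV : T * U * W = V) (hW : U * T * W = 1)
    (hW' : ∀ k, ∀ v ∈ filtration (G := G) k, W v - v ∈ filtration (k + 1)) :
    HasLeadingTerm V (m + 1) (GrLCS.bracket m 0 (m + 1) rfl a c) := by
  -- Since `UTW = 1`, `V - 1 = (TU - UT)W`, which is the commutator of `T - 1` and `U - 1` followed
  -- by `W`. As `W` is unipotent it does not affect leading terms, and the Jacobi identity gives the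
  -- adjoint action.
  have key : ∀ v, V v - v = (T (U (W v) - W v) - (U (W v) - W v)) -
      (U (T (W v) - W v) - (T (W v) - W v)) := by
    intro v
    have h1 : U (T (W v)) = v := by
      rw [← Module.End.mul_apply, ← Module.End.mul_apply, hW, Module.End.one_apply]
    rw [← hV, Module.End.mul_apply, Module.End.mul_apply, map_sub, map_sub, h1]
    abel
  have hWk : ∀ k, ∀ v ∈ filtration (G := G) k, W v ∈ filtration k := by
    intro k v hv
    have := add_mem (filtration_antitone (Nat.le_succ k) (hW' k v hv)) hv
    rwa [sub_add_cancel] at this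
  refine ⟨fun k v hv => ?_, fun i k hk v hv => ?_, ?_⟩
  · have hv' := hWk k v hv
    rw [key]
    exact _root_.sub_mem (filtration_antitone (by omega) (hT.sub_mem _ _ (hU.sub_mem _ _ hv')))
      (filtration_antitone (by omega) (hU.sub_mem _ _ (hT.sub_mem _ _ hv')))
  · have hv' := hWk (i + 1) v hv
    have hvi : (W v).2 i = v.2 i := by
      have := (hW' _ v hv).2 i (by omega)
      rwa [Prod.snd_sub, Pi.sub_apply, sub_eq_zero] at this
    rw [key, Prod.snd_sub, Pi.sub_apply,
      hT.ad (i + 1) k (by omega) _ (filtration_antitone (by omega) (hU.sub_mem _ _ hv')),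
      hU.ad (m + i + 1) k (by omega) _ (filtration_antitone (by omega) (hT.sub_mem _ _ hv')),
      hU.ad i (i + 1) (by omega) _ hv', hT.ad i (m + i + 1) rfl _ hv', hvi]
    ext q
    simp only [RatHom.sub_apply, RatHom.map_apply]
    exact (GrLCS.bracket_bracket _ _ _ _ _ _ _ _ _).symm
  -- At the base point the two products contribute `[a, c]` and `(m + 1)[c, a]`. Their difference is
  -- `(m + 2)[a, c]`, which is where Dynkin's factor grows by one.
  · set e : DynkinSpace G := basePoint
    have he := mem_filtration_zero e
    have hWe := hW' 0 e he
    have hUe : (U (W e) - W e).2 0 = (U e - e).2 0 := by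
      have h := (hU.sub_mem _ _ hWe).2 0 (by omega)
      rw [map_sub] at h
      rw [← sub_eq_zero, ← Pi.sub_apply, ← Prod.snd_sub, ← h, sub_sub_sub_comm]
    have hTe : (T (W e) - W e).2 m = (T e - e).2 m := by
      have h := (hT.sub_mem _ _ hWe).2 m (by omega)
      rw [map_sub] at h
      rw [← sub_eq_zero, ← Pi.sub_apply, ← Prod.snd_sub, ← h, sub_sub_sub_comm]
    have hU' := hU.sub_mem 0 _ (mem_filtration_zero (W e))
    have hT' := hT.sub_mem 0 _ (mem_filtration_zero (W e))
    rw [key, Prod.snd_sub, Pi.sub_apply,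
      hT.ad 0 (m + 1) rfl _ (filtration_antitone (by omega) hU'),
      hU.ad m (m + 1) (by omega) _ (filtration_antitone (by omega) hT'), hUe, hTe,
      RatHom.sub_apply, RatHom.map_apply, RatHom.map_apply, hU.der, hT.der, map_nsmul,
      map_nsmul, GrLCS.bracket_swap (show m + 1 = 0 + m + 1 by omega) rfl]
    rw [zero_add, one_smul, smul_neg, sub_neg_eq_add, ← succ_nsmul']

end HasLeadingTerm

section Rep

variable {n : ℕ} (hn : (⊤ : Subgroup G).lowerCentralSeries n = ⊥)
  {Ω : Type*} (w : Ω → Multiplicative ℚ →* G)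

theorem hasLeadingTerm_expShift (w : Multiplicative ℚ →* G) (q : Multiplicative ℚ) :
    HasLeadingTerm (expShift hn w q) 0 (GrLCS.cls 0 (w q) (GrLCS.mem_zero _)) := by
  have key : ∀ k, ∀ v ∈ filtration (G := G) k,
      expShift hn w q v - v - q.toAdd • shift w v ∈ filtration (k + 2) :=
    fun k v hv => exp_smul_shift_sub_mem hn w q.toAdd hv
  refine ⟨fun k v hv => ?_, fun i k hk v hv => ?_, ?_⟩
  · have := add_mem (filtration_antitone (Nat.le_succ _) (key k v hv))
      (Submodule.smul_mem _ q.toAdd (shift_mem w hv))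
    rwa [sub_add_cancel] at this
  · obtain rfl : k = i + 1 := by omega
    have h := (key _ v hv).2 (i + 1) (by omega)
    rw [Prod.snd_sub, Pi.sub_apply, sub_eq_zero] at h
    rw [h]
    ext r
    change GrLCS.bracket 0 i (i + 1) _ (oneParam w 1) (v.2 i (r * q.toAdd)) =
      GrLCS.bracket 0 i (i + 1) _ (oneParam w q.toAdd) (v.2 i r)
    -- The exponential puts the scalar on `v`, the adjoint action puts it on the one-parameter
    -- subgroup.
    rw [RatHom.balanced _ (oneParam w) (v.2 i) q.toAdd]
  · have h := (key _ _ (mem_filtration_zero basePoint)).2 0 (by omega)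
    rw [Prod.snd_sub, Pi.sub_apply, sub_eq_zero] at h
    rw [h, zero_add, one_smul]
    change oneParam w (1 * q.toAdd * 1) = _
    rw [one_mul, mul_one, oneParam_apply]
    rfl

theorem hasLeadingTerm_rep_zero (g : RatFreeProduct Ω) :
    HasLeadingTerm (rep hn w g) 0
      (GrLCS.cls 0 (Monoid.CoprodI.lift w g) (GrLCS.mem_zero _)) := by
  induction g using Monoid.CoprodI.induction_on with
  | one =>
    convert HasLeadingTerm.one (G := G) 0 using 1
    · exact map_one _
    · simp only [map_one, GrLCS.cls_one]
  | of i q => simpa [rep] using hasLeadingTerm_expShift hn (w i) q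
  | mul g h hg hh =>
    convert hg.mul hh using 1
    · exact map_mul _ _ _
    · simp only [map_mul]
      exact GrLCS.cls_mul (GrLCS.mem_zero _) (GrLCS.mem_zero _)

theorem lift_mem_lowerCentralSeries {m : ℕ} {h : RatFreeProduct Ω}
    (hh : h ∈ (⊤ : Subgroup (RatFreeProduct Ω)).lowerCentralSeries m) :
    Monoid.CoprodI.lift w h ∈ (⊤ : Subgroup G).lowerCentralSeries m :=
  by
  have := Subgroup.mem_map_of_mem (Monoid.CoprodI.lift w) hh
  rw [Subgroup.map_lowerCentralSeries] at this
  exact Subgroup.lowerCentralSeries_mono m le_top this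

theorem hasLeadingTerm_rep {m : ℕ} {h : RatFreeProduct Ω}
    (hh : h ∈ (⊤ : Subgroup (RatFreeProduct Ω)).lowerCentralSeries m) :
    HasLeadingTerm (rep hn w h) m
      (GrLCS.cls m (Monoid.CoprodI.lift w h) (lift_mem_lowerCentralSeries w hh)) := by
  induction m generalizing h with
  | zero => exact hasLeadingTerm_rep_zero hn w h
  | succ m ih =>
    have hh' : h ∈ Subgroup.closure {x | ∃ a ∈ (⊤ : Subgroup (RatFreeProduct Ω)).lowerCentralSeries m, ∃ b ∈ (⊤ : Subgroup _),
        ⁅a, b⁆ = x} := hh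
    suffices H : ∃ hh, HasLeadingTerm (rep hn w h) (m + 1)
        (GrLCS.cls (m + 1) (Monoid.CoprodI.lift w h) hh) from H.2
    clear hh
    induction hh' using Subgroup.closure_induction with
    | one =>
      refine ⟨by rw [map_one]; exact one_mem _, ?_⟩
      convert HasLeadingTerm.one (G := G) (m + 1) using 1
      · exact map_one _
      · simp only [map_one, GrLCS.cls_one]
    | mul x y _ _ hx hy =>
      obtain ⟨hx, hx'⟩ := hx
      obtain ⟨hy, hy'⟩ := hy
      refine ⟨by rw [map_mul]; exact mul_mem hx hy, ?_⟩
      convert hx'.mul hy' using 1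
      · exact map_mul _ _ _
      · simp only [map_mul, GrLCS.cls_mul hx hy]
    | inv x _ hx =>
      obtain ⟨hx, hx'⟩ := hx
      refine ⟨by rw [map_inv]; exact inv_mem hx, ?_⟩
      convert hx'.of_mul_eq_one (U := rep hn w x⁻¹)
        (by rw [← map_mul, inv_mul_cancel, map_one])
        (hasLeadingTerm_rep_zero hn w x⁻¹).sub_mem using 1
      simp only [map_inv, GrLCS.cls_inv hx]
    | mem x hx =>
      obtain ⟨a, ha, b, hb, rfl⟩ := hx
      have hc : ⁅a, b⁆ ∈ (⊤ : Subgroup (RatFreeProduct Ω)).lowerCentralSeries (m + 1) :=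
        Subgroup.commutator_mem_commutator ha hb
      refine ⟨lift_mem_lowerCentralSeries w hc, ?_⟩
      convert (ih ha).commutator (hasLeadingTerm_rep_zero hn w b) (V := rep hn w ⁅a, b⁆)
        (W := rep hn w (a⁻¹ * b⁻¹))
        (by rw [← map_mul, ← map_mul, commutatorElement_def]; simp only [mul_assoc])
        (by rw [← map_mul, ← map_mul, ← map_one (rep hn w)]; congr 1; group)
        (hasLeadingTerm_rep_zero hn w (a⁻¹ * b⁻¹)).sub_mem using 1
      rw [GrLCS.bracket_cls]
      simp only [map_commutatorElement]

end Rep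

/-- Leading terms add under multiplication. This form keeps the whole vector of a `ℚ`-space, where
`j` can be cancelled, rather than its value in a group that may have torsion. -/
theorem smul_snd_basePoint_pow {T : Module.End ℚ (DynkinSpace G)} {m : ℕ} {a : GrLCS G m}
    (hT : HasLeadingTerm T m a) (j : ℕ) :
    ((T ^ j) basePoint - basePoint).2 m = j • (T basePoint - basePoint).2 m := by
  induction j with
  | zero => simp
  | succ j ih =>
    have h := (hT.sub_mem _ _ (mem_filtration_zero basePoint))
    -- Powers of `T` are unipotent, so `T ^ j` fixes `T basePoint - basePoint` in its leading
    -- degree.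
    have hpow : ∀ j : ℕ, ∀ k, ∀ v ∈ filtration (G := G) k, (T ^ j) v - v ∈ filtration (k + 1) := by
      intro j
      induction j with
      | zero => intro k v _; simp
      | succ j ih =>
        intro k v hv
        have h1 := hT.sub_mem k v hv
        have h2 := ih _ _ h1
        rw [map_sub] at h2
        have h3 : (T ^ (j + 1)) v - v = ((T ^ j) (T v) - (T ^ j) v - (T v - v)) +
            (((T ^ j) v - v) + (T v - v)) := by
          rw [pow_succ, Module.End.mul_apply]
          abel
        rw [h3]
        exact add_mem (filtration_antitone (by omega) h2)
          (add_mem (ih k v hv) (filtration_antitone (by omega) h1))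
    have h2 := (hpow j _ _ h).2 m (by omega)
    rw [map_sub] at h2
    have h3 : (T ^ (j + 1)) basePoint - basePoint =
        ((T ^ j) (T basePoint) - (T ^ j) basePoint - (T basePoint - basePoint)) +
          (((T ^ j) basePoint - basePoint) + (T basePoint - basePoint)) := by
      rw [pow_succ, Module.End.mul_apply]
      abel
    rw [h3, Prod.snd_add, Pi.add_apply, h2, zero_add, Prod.snd_add, Pi.add_apply, ih, succ_nsmul]

/-- An element of a term of the lower central series of a free product of copies of `ℚ` that is
torsion modulo the next term has order dividing `m + 1` there. -/
theorem _root_.Monoid.CoprodI.pow_succ_mem_lowerCentralSeries {Ω : Type*} {m : ℕ}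
    {h : RatFreeProduct Ω}
    (hh : h ∈ (⊤ : Subgroup (RatFreeProduct Ω)).lowerCentralSeries m)
    {j : ℕ} (hj : j ≠ 0)
    (hhj : h ^ j ∈
      (⊤ : Subgroup (RatFreeProduct Ω)).lowerCentralSeries (m + 1)) :
    h ^ (m + 1) ∈
      (⊤ : Subgroup (RatFreeProduct Ω)).lowerCentralSeries (m + 1) := by
  -- The representation is built from the nilpotent quotient by `L`, in which the class of `h` in
  -- degree `m` is trivial exactly when `h` lies in `L`.
  let L := (⊤ : Subgroup (RatFreeProduct Ω)).lowerCentralSeries (m + 1)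
  let w : Ω → Multiplicative ℚ →* (RatFreeProduct Ω ⧸ L) :=
    fun ω => (QuotientGroup.mk' L).comp
      (Monoid.CoprodI.of (M := fun _ : Ω => Multiplicative ℚ) (i := ω))
  have hw : Monoid.CoprodI.lift w = QuotientGroup.mk' L := by
    refine Monoid.CoprodI.ext_hom _ _ fun ω => ?_
    rw [Monoid.CoprodI.lift_comp_of]
  have hn : (⊤ : Subgroup (RatFreeProduct Ω ⧸ L)).lowerCentralSeries
      (m + 1) = ⊥ := by
    rw [← Subgroup.map_top_of_surjective (QuotientGroup.mk' L) (QuotientGroup.mk'_surjective L),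
      ← Subgroup.map_lowerCentralSeries, Subgroup.map_eq_bot_iff, QuotientGroup.ker_mk']
  have h1 := hasLeadingTerm_rep hn w hh
  have h2 := smul_snd_basePoint_pow h1 j
  rw [← map_pow, ((hasLeadingTerm_rep hn w hhj).sub_mem 0 _ (mem_filtration_zero _)).2 m (by omega),
    ← Nat.cast_smul_eq_nsmul ℚ] at h2
  have h3 := (smul_eq_zero.1 h2.symm).resolve_left (by exact_mod_cast hj)
  have h4 := h1.der
  rw [h3, RatHom.zero_apply, ← GrLCS.cls_pow] at h4
  have h5 := (GrLCS.cls_eq_zero_iff _).1 h4.symm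
  rw [hn, Subgroup.mem_bot, ← map_pow, hw] at h5
  exact (QuotientGroup.eq_one_iff _).1 h5

end DynkinSpace

end Dynkin

/-! ### Roots along iterated commutators -/

theorem commutatorElement_pow_left {G : Type*} [Group G] {w g : G} (h : Commute ⁅w, g⁆ w) (n : ℕ) :
    ⁅w ^ n, g⁆ = ⁅w, g⁆ ^ n := by
  have h1 : g * w * g⁻¹ = ⁅w, g⁆⁻¹ * w := by rw [commutatorElement_def]; group
  have h2 : (g * w * g⁻¹) ^ n = (⁅w, g⁆ ^ n)⁻¹ * w ^ n := by
    rw [h1, h.inv_left.mul_pow, inv_pow]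
  have h3 : ⁅w ^ n, g⁆ = w ^ n * (g * w ^ n * g⁻¹)⁻¹ := by rw [commutatorElement_def]; group
  rw [h3, ← conj_pow, h2, mul_inv_rev, inv_inv, mul_inv_cancel_left]

theorem commutatorElement_pow_right {G : Type*} [Group G] {w g : G} (h : Commute ⁅g, w⁆ w) (n : ℕ) :
    ⁅g, w ^ n⁆ = ⁅g, w⁆ ^ n := by
  rw [← commutatorElement_inv, commutatorElement_pow_left, ← inv_pow, commutatorElement_inv]
  rw [← commutatorElement_inv]
  exact h.inv_left

namespace Subgroup

variable {G : Type*} [Group G]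

theorem commute_mk_of_mem {H : Subgroup G} [H.Normal] {x : G} (hx : x ∈ H) (y : G) :
    Commute (x : G ⧸ ⁅H, (⊤ : Subgroup G)⁆) y := by
  rw [← commutatorElement_eq_one_iff_commute]
  exact (QuotientGroup.eq_one_iff (N := ⁅H, (⊤ : Subgroup G)⁆) _).2
    (commutator_mem_commutator hx (mem_top y))

/-- If `h ≡ w ^ n` modulo `[H, G]`, then one term deeper `[h, g] ≡ [w ^ n, g] ≡ [w, g] ^ n`, because
`[w, g]` is central there. Products are handled by the same centrality. -/
theorem exists_pow_eq_mk_commutator {H : Subgroup G} [H.Normal] {n : ℕ}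
    (hH : ∀ z ∈ H, ∃ w ∈ H, (z : G ⧸ ⁅H, (⊤ : Subgroup G)⁆) = w ^ n) :
    ∀ z ∈ ⁅H, (⊤ : Subgroup G)⁆, ∃ w ∈ ⁅H, (⊤ : Subgroup G)⁆,
      (z : G ⧸ ⁅⁅H, (⊤ : Subgroup G)⁆, (⊤ : Subgroup G)⁆) = w ^ n := by
  intro z hz
  rw [commutator_def] at hz
  induction hz using closure_induction with
  | mem x hx =>
    obtain ⟨h, hh, g, -, rfl⟩ := hx
    obtain ⟨w, hw, hwh⟩ := hH h hh
    have hc : ⁅w, g⁆ ∈ ⁅H, (⊤ : Subgroup G)⁆ := commutator_mem_commutator hw (mem_top g)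
    refine ⟨_, hc, ?_⟩
    have hz : (w ^ n)⁻¹ * h ∈ ⁅H, (⊤ : Subgroup G)⁆ := QuotientGroup.eq.1 hwh.symm
    have h1 := (commute_mk_of_mem hz g).commutator_eq
    have h2 : h = w ^ n * ((w ^ n)⁻¹ * h) := by group
    have h3 := commutatorElement_pow_left
      (G := G ⧸ ⁅⁅H, (⊤ : Subgroup G)⁆, (⊤ : Subgroup G)⁆) (w := w) (g := g)
      (commute_mk_of_mem hc w) n
    have h4 : (⁅h, g⁆ : G) = w ^ n * ⁅(w ^ n)⁻¹ * h, g⁆ * (w ^ n)⁻¹ * ⁅w ^ n, g⁆ := by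
      rw [← commutatorElement_mul_left_eq_conj_mul, ← h2]
    have h5 : ((⁅(w ^ n)⁻¹ * h, g⁆ : G) : G ⧸ ⁅⁅H, (⊤ : Subgroup G)⁆, (⊤ : Subgroup G)⁆) = 1 := h1
    rw [h4, QuotientGroup.mk_mul, QuotientGroup.mk_mul, QuotientGroup.mk_mul, h5, mul_one,
      QuotientGroup.mk_inv, mul_inv_cancel, one_mul]
    exact h3
  | one => exact ⟨1, one_mem _, by simp⟩
  | mul x y _ _ hx hy =>
    obtain ⟨a, ha, hxa⟩ := hx
    obtain ⟨b, hb, hyb⟩ := hy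
    refine ⟨a * b, mul_mem ha hb, ?_⟩
    rw [QuotientGroup.mk_mul, QuotientGroup.mk_mul, hxa, hyb, (commute_mk_of_mem ha b).mul_pow]
  | inv x _ hx =>
    obtain ⟨a, ha, hxa⟩ := hx
    refine ⟨a⁻¹, inv_mem ha, ?_⟩
    rw [QuotientGroup.mk_inv, QuotientGroup.mk_inv, hxa, inv_pow]

/-- The iterated commutators of a subgroup with the whole group. -/
def iteratedCommutator (H : Subgroup G) : ℕ → Subgroup G
  | 0 => H
  | n + 1 => ⁅H.iteratedCommutator n, (⊤ : Subgroup G)⁆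

instance iteratedCommutator_normal (H : Subgroup G) [H.Normal] (n : ℕ) :
    (H.iteratedCommutator n).Normal := by
  induction n with
  | zero => assumption
  | succ n ih => exact commutator_normal _ _

theorem iteratedCommutator_le_lowerCentralSeries (H : Subgroup G) (n : ℕ) :
    H.iteratedCommutator n ≤ (⊤ : Subgroup G).lowerCentralSeries n := by
  induction n with
  | zero => exact le_top
  | succ n ih => exact commutator_mono ih le_rfl

theorem exists_pow_eq_mk_iteratedCommutator {H : Subgroup G} [H.Normal] {n : ℕ}
    (hH : ∀ z ∈ H, ∃ w ∈ H, (z : G ⧸ ⁅H, (⊤ : Subgroup G)⁆) = w ^ n) (i : ℕ) :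
    ∀ z ∈ H.iteratedCommutator i, ∃ w ∈ H.iteratedCommutator i,
      (z : G ⧸ ⁅H.iteratedCommutator i, (⊤ : Subgroup G)⁆) = w ^ n := by
  induction i with
  | zero => exact hH
  | succ i ih => exact exists_pow_eq_mk_commutator ih

/-- Successive approximation: the error at stage `i` has a root `w` modulo the next term. As `w` is
central there, `(a * w) ^ n` absorbs the error. -/
theorem exists_pow_inv_mul_mem_iteratedCommutator {H : Subgroup G} [H.Normal] {n : ℕ}
    (hH : ∀ z ∈ H, ∃ w ∈ H, (z : G ⧸ ⁅H, (⊤ : Subgroup G)⁆) = w ^ n) (j i : ℕ) :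
    ∀ t ∈ H.iteratedCommutator j, ∃ a ∈ H.iteratedCommutator j,
      (a ^ n)⁻¹ * t ∈ H.iteratedCommutator (j + i) := by
  intro t ht
  have hle : ∀ i, H.iteratedCommutator (j + i) ≤ H.iteratedCommutator j := by
    intro i
    induction i with
    | zero => exact le_rfl
    | succ i ih => exact (commutator_le_left _ _).trans ih
  induction i with
  | zero => exact ⟨1, one_mem _, by rw [one_pow, inv_one, one_mul]; exact ht⟩
  | succ i ih =>
    obtain ⟨a, ha, haz⟩ := ih
    obtain ⟨w, hw, hwz⟩ := exists_pow_eq_mk_iteratedCommutator hH (j + i) _ haz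
    refine ⟨a * w, mul_mem ha (hle i hw), ?_⟩
    refine QuotientGroup.eq.1 ?_
    have hc := (commute_mk_of_mem hw a).symm
    have h2 : (t : G ⧸ ⁅H.iteratedCommutator (j + i), (⊤ : Subgroup G)⁆) =
      (a : G ⧸ ⁅H.iteratedCommutator (j + i), (⊤ : Subgroup G)⁆) ^ n *
        (((a ^ n)⁻¹ * t : G) : G ⧸ ⁅H.iteratedCommutator (j + i), (⊤ : Subgroup G)⁆) := by
      rw [← QuotientGroup.mk_pow, ← QuotientGroup.mk_mul, mul_inv_cancel_left]
    refine Eq.trans ?_ (h2.trans (congrArg _ hwz)).symm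
    exact hc.mul_pow n

end Subgroup

/-! ### Unique divisibility modulo the lower central series -/

namespace RatFreeProduct

variable {Ω : Type*}

theorem exists_pow_eq_mk {n : ℕ} (hn : n ≠ 0) (g : RatFreeProduct Ω) :
    ∃ w, (g : RatFreeProduct Ω ⧸ ⁅(⊤ : Subgroup (RatFreeProduct Ω)),
      (⊤ : Subgroup (RatFreeProduct Ω))⁆) = w ^ n := by
  induction g using Monoid.CoprodI.induction_on with
  | one => exact ⟨1, by simp⟩
  | of i q =>
    refine ⟨(Monoid.CoprodI.of (M := fun _ : Ω => Multiplicative ℚ) (i := i)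
      (Multiplicative.ofAdd (q.toAdd / n)) : RatFreeProduct Ω), ?_⟩
    rw [← QuotientGroup.mk_pow, ← map_pow, ← ofAdd_nsmul, nsmul_eq_mul,
      mul_div_cancel₀ _ (by exact_mod_cast hn : (n : ℚ) ≠ 0), ofAdd_toAdd]
  | mul g h hg hh =>
    obtain ⟨a, ha⟩ := hg
    obtain ⟨b, hb⟩ := hh
    obtain ⟨a, rfl⟩ := QuotientGroup.mk_surjective a
    obtain ⟨b, rfl⟩ := QuotientGroup.mk_surjective b
    refine ⟨a * b, ?_⟩
    rw [QuotientGroup.mk_mul, ha, hb, (Subgroup.commute_mk_of_mem (Subgroup.mem_top a) b).mul_pow]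

/-- The lower central factors of a free product of copies of `ℚ` are torsion-free. -/
theorem mem_lowerCentralSeries_succ {m : ℕ} {h : RatFreeProduct Ω}
    (hh : h ∈ (⊤ : Subgroup (RatFreeProduct Ω)).lowerCentralSeries m) {j : ℕ} (hj : j ≠ 0)
    (hhj : h ^ j ∈ (⊤ : Subgroup (RatFreeProduct Ω)).lowerCentralSeries (m + 1)) :
    h ∈ (⊤ : Subgroup (RatFreeProduct Ω)).lowerCentralSeries (m + 1) := by
  have hdiv : ∀ i, ∀ z ∈ (⊤ : Subgroup (RatFreeProduct Ω)).lowerCentralSeries i,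
      ∃ w ∈ (⊤ : Subgroup (RatFreeProduct Ω)).lowerCentralSeries i,
        (z : RatFreeProduct Ω ⧸ ⁅(⊤ : Subgroup (RatFreeProduct Ω)).lowerCentralSeries i,
          (⊤ : Subgroup (RatFreeProduct Ω))⁆) = w ^ (m + 1) := by
    intro i
    induction i with
    | zero =>
      intro z _
      obtain ⟨w, hw⟩ := exists_pow_eq_mk m.succ_ne_zero z
      obtain ⟨w, rfl⟩ := QuotientGroup.mk_surjective w
      exact ⟨w, Subgroup.mem_top w, hw⟩
    | succ i ih => exact Subgroup.exists_pow_eq_mk_commutator ih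
  -- Dynkin's argument only bounds the torsion by `m + 1`. An `(m + 1)`-th root `w` of `h` in the
  -- factor is again torsion, so its `(m + 1)`-th power, which is `h`, is trivial.
  obtain ⟨w, hw, hwh⟩ := hdiv m h hh
  have h1 : (w ^ ((m + 1) * j)) ∈ (⊤ : Subgroup (RatFreeProduct Ω)).lowerCentralSeries (m + 1) := by
    refine (QuotientGroup.eq_one_iff _).1 ?_
    rw [QuotientGroup.mk_pow, pow_mul]
    refine (congrArg (· ^ j) hwh.symm).trans ?_
    exact (QuotientGroup.eq_one_iff _).2 hhj
  have h2 := Monoid.CoprodI.pow_succ_mem_lowerCentralSeries hw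
    (mul_ne_zero m.succ_ne_zero hj) h1
  refine (QuotientGroup.eq_one_iff _).1 (hwh.trans ?_)
  exact (QuotientGroup.eq_one_iff _).2 h2

/-- Roots are unique modulo the terms of the lower central series. -/
theorem inv_mul_mem_lowerCentralSeries {j : ℕ} (hj : j ≠ 0) {s t : RatFreeProduct Ω} (n : ℕ)
    (h : (t ^ j)⁻¹ * s ^ j ∈ (⊤ : Subgroup (RatFreeProduct Ω)).lowerCentralSeries n) :
    t⁻¹ * s ∈ (⊤ : Subgroup (RatFreeProduct Ω)).lowerCentralSeries n := by
  induction n with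
  | zero => exact Subgroup.mem_top _
  | succ n ih =>
    have hz := ih (Subgroup.lowerCentralSeries_antitone _ n.le_succ h)
    refine mem_lowerCentralSeries_succ hz hj ((QuotientGroup.eq_one_iff _).1 ?_)
    -- Modulo the next term `t⁻¹ * s` is central, so its `j`-th power is the quotient of the `j`-th
    -- powers of `s` and `t`.
    have hc := (Subgroup.commute_mk_of_mem hz t).symm.mul_pow j
    have hs := QuotientGroup.eq.2 h
    rw [← QuotientGroup.mk_mul, mul_inv_cancel_left, ← QuotientGroup.mk_pow] at hc
    exact (mul_eq_left.1 ((hs.trans hc).symm.trans rfl))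

theorem exists_pow_inv_mul_mem_lowerCentralSeries {j : ℕ} (hj : j ≠ 0) (n : ℕ)
    (g : RatFreeProduct Ω) :
    ∃ a, (a ^ j)⁻¹ * g ∈ (⊤ : Subgroup (RatFreeProduct Ω)).lowerCentralSeries n := by
  obtain ⟨a, -, ha⟩ := Subgroup.exists_pow_inv_mul_mem_iteratedCommutator (H := ⊤) (n := j)
    (fun z _ => by
      obtain ⟨w, hw⟩ := exists_pow_eq_mk hj z
      obtain ⟨w, rfl⟩ := QuotientGroup.mk_surjective w
      exact ⟨w, Subgroup.mem_top w, hw⟩) 0 n g (Subgroup.mem_top g)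
  rw [zero_add] at ha
  exact ⟨a, Subgroup.iteratedCommutator_le_lowerCentralSeries ⊤ n ha⟩

/-- Inside `[S, F]` there is `a` with `a ^ j` equal to `s ^ j` modulo a deep term of the lower
central series. Uniqueness of roots then makes `a` and `s` agree modulo that term, which lies in
`[S, F]`. -/
theorem mem_commutator_of_pow_mem {S : Subgroup (RatFreeProduct Ω)} [S.Normal] {j n : ℕ}
    (hj : j ≠ 0) (hS : ∀ z ∈ S, ∃ w ∈ S,
      (z : RatFreeProduct Ω ⧸ ⁅S, (⊤ : Subgroup (RatFreeProduct Ω))⁆) = w ^ j)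
    (hn : (⊤ : Subgroup (RatFreeProduct Ω)).lowerCentralSeries n ≤ S) {s : RatFreeProduct Ω}
    (hs : s ^ j ∈ ⁅S, (⊤ : Subgroup (RatFreeProduct Ω))⁆) :
    s ∈ ⁅S, (⊤ : Subgroup (RatFreeProduct Ω))⁆ := by
  obtain ⟨a, ha, has⟩ := Subgroup.exists_pow_inv_mul_mem_iteratedCommutator hS 1 n _ hs
  rw [add_comm] at has
  have h := inv_mul_mem_lowerCentralSeries hj (n + 1)
    (Subgroup.iteratedCommutator_le_lowerCentralSeries S (n + 1) has)
  have h' : a⁻¹ * s ∈ ⁅S, (⊤ : Subgroup (RatFreeProduct Ω))⁆ :=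
    Subgroup.commutator_mono hn le_rfl h
  have ha' : a ∈ ⁅S, (⊤ : Subgroup (RatFreeProduct Ω))⁆ := ha
  simpa using mul_mem ha' h'

end RatFreeProduct

/-! ### Radicable groups: central torsion and one-parameter subgroups -/

/-- The torsion subgroup of a radicable nilpotent group is central. -/
theorem nilTorsion_le_center {R : Type*} [Group R] [Group.IsNilpotent R] (hR : IsRadicable R) :
    nilTorsion R ≤ Subgroup.center R := by
  intro u hu
  obtain ⟨k, hk, huk⟩ := isOfFinOrder_iff_pow_eq_one.1 (show IsOfFinOrder u from hu)
  have step : ∀ n, u ∈ Subgroup.upperCentralSeries R (n + 2) →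
      u ∈ Subgroup.upperCentralSeries R (n + 1) := by
    intro n hun y
    -- With `y = s ^ k`, one step down the upper central series `[u, y] = [u, s] ^ k = [u ^ k, s] =
    -- 1`.
    obtain ⟨s, rfl⟩ := hR k (by exact_mod_cast hk.ne') y
    have hc : ⁅u, s⁆ ∈ Subgroup.upperCentralSeries R (n + 1) := hun s
    have hcomm : ∀ z : R, Commute ((⁅u, s⁆ : R) : R ⧸ Subgroup.upperCentralSeries R n) z := by
      intro z
      rw [← commutatorElement_eq_one_iff_commute]
      exact (QuotientGroup.eq_one_iff (N := Subgroup.upperCentralSeries R n) _).2 (hc z)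
    have h1 := commutatorElement_pow_left (G := R ⧸ Subgroup.upperCentralSeries R n)
      (w := u) (g := s) (hcomm u) k
    have h2 := commutatorElement_pow_right (G := R ⧸ Subgroup.upperCentralSeries R n)
      (w := s) (g := u) (hcomm s) k
    have h3 : ((u : R ⧸ Subgroup.upperCentralSeries R n)) ^ k = 1 := by
      rw [← QuotientGroup.mk_pow, huk, QuotientGroup.mk_one]
    rw [h3, commutatorElement_one_left] at h1
    refine (QuotientGroup.eq_one_iff (N := Subgroup.upperCentralSeries R n) _).1 ?_
    rw [zpow_natCast]
    exact h2.trans h1.symm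
  have descend : ∀ n, u ∈ Subgroup.upperCentralSeries R (n + 1) →
      u ∈ Subgroup.upperCentralSeries R 1 := by
    intro n
    induction n with
    | zero => exact id
    | succ n ih => exact fun h => ih (step n h)
  rw [← Subgroup.upperCentralSeries_one]
  obtain ⟨n, hn⟩ := Group.IsNilpotent.nilpotent R
  refine descend n ?_
  exact Subgroup.upperCentralSeries_mono R n.le_succ (hn ▸ Subgroup.mem_top u)

/-- In a radicable group every element lies on a one-parameter subgroup. -/
theorem IsRadicable.exists_hom {R : Type*} [Group R] (hR : IsRadicable R) (r : R) :
    ∃ f : Multiplicative ℚ →* R, f (Multiplicative.ofAdd 1) = r := by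
  choose root hroot using fun (k : ℕ) => hR ((k : ℤ) + 1) (by positivity)
  -- The element `a k` plays the role of `r ^ (1 / k!)`. The value at `q` is `a k ^ (q * k!)` for
  -- any `k` with `q * k!` integral; `k = q.den` is one such choice.
  let a : ℕ → R := fun k => Nat.rec r (fun k x => root k x) k
  have ha : ∀ k, a (k + 1) ^ ((k : ℤ) + 1) = a k := fun k => hroot k (a k)
  have hexp : ∀ k d : ℕ, ∃ z : ℤ, a k = a (k + d) ^ z ∧ z * k.factorial = (k + d).factorial := by
    intro k d
    induction d with
    | zero => exact ⟨1, by simp, by simp⟩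
    | succ d ih =>
      obtain ⟨z, hz, hz'⟩ := ih
      refine ⟨((k + d : ℕ) + 1) * z, ?_, ?_⟩
      · rw [zpow_mul, ← add_assoc, ha, hz]
      · rw [mul_assoc, hz', ← add_assoc, Nat.factorial_succ]
        push_cast
        ring
  have hle : ∀ (q : ℚ) (k l : ℕ) (z z' : ℤ), k ≤ l → q * k.factorial = z → q * l.factorial = z' →
      a k ^ z = a l ^ z' := by
    intro q k l z z' hkl hz hz'
    obtain ⟨d, rfl⟩ := Nat.exists_eq_add_of_le hkl
    obtain ⟨y, hy, hy'⟩ := hexp k d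
    have hyz : y * z = z' := by
      have h1 : ((y * k.factorial : ℤ) : ℚ) = ((k + d).factorial : ℤ) := by rw [hy']
      push_cast at h1
      have h2 : ((y * z : ℤ) : ℚ) = z' := by
        push_cast
        rw [← hz, ← hz', ← h1]
        ring
      exact_mod_cast h2
    rw [hy, ← zpow_mul, hyz]
  have hint : ∀ (q : ℚ) (l : ℕ), q.den ≤ l → ∃ z : ℤ, q * l.factorial = z := by
    intro q l hl
    obtain ⟨c, hc⟩ := Nat.dvd_factorial q.pos hl
    refine ⟨q.num * c, ?_⟩
    rw [hc]
    push_cast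
    rw [← mul_assoc, Rat.mul_den_eq_num]
  choose z hz using fun q : ℚ => hint q q.den le_rfl
  have hspec : ∀ (q : ℚ) (l : ℕ) (y : ℤ), q.den ≤ l → q * l.factorial = y →
      a q.den ^ z q = a l ^ y := fun q l y hl hy => hle q _ _ _ _ hl (hz q) hy
  refine ⟨MonoidHom.mk' (fun q => a q.toAdd.den ^ z q.toAdd) ?_, ?_⟩
  · intro q q'
    set x := q.toAdd
    set x' := q'.toAdd
    change a (x + x').den ^ z (x + x') = a x.den ^ z x * a x'.den ^ z x'
    let l := max (x + x').den (max x.den x'.den)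
    obtain ⟨y, hy⟩ := hint x l (by omega)
    obtain ⟨y', hy'⟩ := hint x' l (by omega)
    rw [hspec x l y (by omega) hy, hspec x' l y' (by omega) hy',
      hspec (x + x') l (y + y') (by omega) (by push_cast; rw [← hy, ← hy']; ring), zpow_add]
  · change a (1 : ℚ).den ^ z 1 = r
    have h := hle 1 0 (1 : ℚ).den 1 (z 1) (Nat.zero_le _) (by simp) (hz 1)
    rw [← h, zpow_one]
    rfl

/-! ### Annihilators of the abelianizations -/

section Annihilator

variable {X : Type*} [Group X]

theorem mem_abAnnihilator_iff {G : Type*} [Group G] [MulDistribMulAction X G]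
    (a : MonoidAlgebra ℤ X) :
    a ∈ abAnnihilator X G ↔
      ∀ v : Additive (Abelianization G), (abelianizationRep X G).asAlgebraHom a v = 0 :=
  Module.mem_annihilator

/-- The map of abelianizations induced by a group homomorphism. -/
def abelianizationLinearMap {G H : Type*} [Group G] [Group H] (f : G →* H) :
    Additive (Abelianization G) →ₗ[ℤ] Additive (Abelianization H) :=
  (MonoidHom.toAdditive (Abelianization.map f)).toIntLinearMap

theorem abelianizationLinearMap_asAlgebraHom {G H : Type*} [Group G] [Group H]
    [MulDistribMulAction X G] [MulDistribMulAction X H] {f : G →* H}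
    (hf : ∀ (x : X) (g : G), f (x • g) = x • f g) (a : MonoidAlgebra ℤ X)
    (v : Additive (Abelianization G)) :
    abelianizationLinearMap f ((abelianizationRep X G).asAlgebraHom a v) =
      (abelianizationRep X H).asAlgebraHom a (abelianizationLinearMap f v) := by
  induction a using MonoidAlgebra.induction_on with
  | of x =>
    simp only [Representation.asAlgebraHom_of]
    obtain ⟨g, rfl⟩ := QuotientGroup.mk_surjective v.toMul
    exact congrArg (fun t : H => Additive.ofMul (Abelianization.of t)) (hf x g)
  | add a b ha hb => simp only [map_add, LinearMap.add_apply, ha, hb]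
  | smul r a ha => simp only [map_smul, LinearMap.smul_apply, ha]

/-- A class in the kernel on abelianizations has a representative `ν w` in `ker ψ`. Then `w ^ p = ψ
(ν w) = 1`, so `p` kills the class. If `a` annihilates the abelianization of `R`, it sends every `v`
upstairs into this kernel, hence kills `p • v`; by radicability these are all the elements. -/
theorem IsPowerCover.abAnnihilator_eq {p : ℕ} (hp : p ≠ 0) {R : Type*} [Group R]
    [Group.IsNilpotent R] [MulDistribMulAction X R] {Rbar : Type*} [Group Rbar]
    [MulDistribMulAction X Rbar] {ψ : Rbar →* R} (h : IsPowerCover X p ψ) :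
    abAnnihilator X Rbar = abAnnihilator X R := by
  have hker : ∀ u : Additive (Abelianization Rbar), abelianizationLinearMap ψ u = 0 →
      p • u = 0 := by
    intro u hu
    obtain ⟨r, rfl⟩ : ∃ r, Additive.ofMul (Abelianization.of r) = u :=
      QuotientGroup.mk_surjective u.toMul
    have h1 : ψ r ∈ commutator R :=
      (QuotientGroup.eq_one_iff (N := commutator R) (ψ r)).1 hu
    have h2 : commutator R = (commutator Rbar).map ψ := by
      rw [commutator_def, commutator_def, Subgroup.map_commutator,
        Subgroup.map_top_of_surjective ψ h.surjective]
    rw [h2] at h1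
    obtain ⟨c, hc, hcr⟩ := h1
    have hk : ψ (r * c⁻¹) = 1 := by rw [map_mul, map_inv, hcr, mul_inv_cancel]
    obtain ⟨ν, -, hν⟩ := h.exists_iso
    obtain ⟨w, hw⟩ := ν.surjective ⟨r * c⁻¹, by rw [Subgroup.mem_comap, hk]; exact one_mem _⟩
    have hw1 : w ^ p = 1 := by
      have := hν w
      rw [hw, hk] at this
      exact Subtype.ext this.symm
    have hpow : (r * c⁻¹) ^ p = 1 := by
      have := congrArg ν hw1
      rw [map_pow, map_one, hw] at this
      exact congrArg Subtype.val this
    have hof : Abelianization.of r = Abelianization.of (r * c⁻¹) := by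
      have hc1 : Abelianization.of c = 1 := (QuotientGroup.eq_one_iff (N := commutator Rbar) c).2 hc
      rw [map_mul, map_inv, hc1, inv_one, mul_one]
    rw [hof, ← ofMul_pow, ← map_pow, hpow, map_one, ofMul_one]
  ext a
  rw [mem_abAnnihilator_iff, mem_abAnnihilator_iff]
  constructor
  · intro ha v
    obtain ⟨r, rfl⟩ : ∃ r, Additive.ofMul (Abelianization.of r) = v :=
      QuotientGroup.mk_surjective v.toMul
    obtain ⟨s, rfl⟩ := h.surjective r
    have := abelianizationLinearMap_asAlgebraHom h.equivariant a
      (Additive.ofMul (Abelianization.of s))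
    rw [ha, map_zero] at this
    exact this.symm
  · intro ha v
    obtain ⟨r, rfl⟩ : ∃ r, Additive.ofMul (Abelianization.of r) = v :=
      QuotientGroup.mk_surjective v.toMul
    obtain ⟨s, rfl⟩ := h.radicable p (by exact_mod_cast hp) r
    rw [zpow_natCast, map_pow, ofMul_pow, map_nsmul]
    apply hker
    rw [abelianizationLinearMap_asAlgebraHom h.equivariant, ha]

end Annihilator

/-! ### Construction of the power cover -/

section Construction

variable {X : Type*} [Group X]

/-- The action on a quotient by an invariant normal subgroup. -/
abbrev quotientMulDistribMulAction {G : Type*} [Group G] [MulDistribMulAction X G]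
    (N : Subgroup G) [N.Normal] (hN : ∀ (x : X), ∀ g ∈ N, x • g ∈ N) :
    MulDistribMulAction X (G ⧸ N) where
  smul x := QuotientGroup.map N N (MulDistribMulAction.toMonoidHom G x) (hN x)
  one_smul g := by
    induction g using QuotientGroup.induction_on with
    | H g => exact congrArg _ (one_smul X g)
  mul_smul x y g := by
    induction g using QuotientGroup.induction_on with
    | H g => exact congrArg _ (mul_smul x y g)
  smul_one x := map_one (QuotientGroup.map N N (MulDistribMulAction.toMonoidHom G x) (hN x))
  smul_mul x := map_mul (QuotientGroup.map N N (MulDistribMulAction.toMonoidHom G x) (hN x))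

/-- The automorphism of the free product induced by letting `x` act on one-parameter subgroups. -/
def ratFreeProductMap {R : Type*} [Group R] [MulDistribMulAction X R] (x : X) :
    RatFreeProduct (Multiplicative ℚ →* R) →* RatFreeProduct (Multiplicative ℚ →* R) :=
  Monoid.CoprodI.lift fun f =>
    Monoid.CoprodI.of (M := fun _ : Multiplicative ℚ →* R => Multiplicative ℚ)
      (i := (MulDistribMulAction.toMonoidHom R x).comp f)

/-- The action on the free product of all one-parameter subgroups of `R`. -/
abbrev ratFreeProductMulDistribMulAction (R : Type*) [Group R] [MulDistribMulAction X R] :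
    MulDistribMulAction X (RatFreeProduct (Multiplicative ℚ →* R)) where
  smul x := ratFreeProductMap x
  one_smul g := by
    suffices h : ratFreeProductMap (R := R) (1 : X) = MonoidHom.id _ from DFunLike.congr_fun h g
    refine Monoid.CoprodI.ext_hom _ _ fun f => ?_
    rw [ratFreeProductMap, Monoid.CoprodI.lift_comp_of, MonoidHom.id_comp]
    congr 1
    ext q
    exact one_smul X _
  mul_smul x y g := by
    suffices h : ratFreeProductMap (R := R) (x * y) =
      (ratFreeProductMap x).comp (ratFreeProductMap y) from DFunLike.congr_fun h g
    refine Monoid.CoprodI.ext_hom _ _ fun f => ?_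
    refine MonoidHom.ext fun q => ?_
    simp only [ratFreeProductMap, MonoidHom.comp_apply, Monoid.CoprodI.lift_of]
    congr 1
    refine congrArg (fun f : Multiplicative ℚ →* R =>
      Monoid.CoprodI.of (M := fun _ : Multiplicative ℚ →* R => Multiplicative ℚ) (i := f)) ?_
    exact MonoidHom.ext fun q => mul_smul x y _
  smul_one x := map_one (ratFreeProductMap x)
  smul_mul x := map_mul (ratFreeProductMap x)

variable {G R : Type*} [Group G] [Group R]

/-- The subgroup of `G` generated modulo `M` by the `p`-th powers of the elements of the kernel of
`φ`, where this kernel is central modulo `M`. -/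
def powKernel (φ : G →* R) (p : ℕ) (M : Subgroup G) [M.Normal]
    (hM : ⁅φ.ker, (⊤ : Subgroup G)⁆ ≤ M) : Subgroup G where
  carrier := {g | ∃ k ∈ φ.ker, (g : G ⧸ M) = k ^ p}
  one_mem' := ⟨1, one_mem _, by simp⟩
  mul_mem' := by
    rintro a b ⟨k, hk, hak⟩ ⟨l, hl, hbl⟩
    have hc : Commute (k : G ⧸ M) l := by
      rw [← commutatorElement_eq_one_iff_commute]
      exact (QuotientGroup.eq_one_iff (N := M) _).2
        (hM (Subgroup.commutator_mem_commutator hk (Subgroup.mem_top l)))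
    refine ⟨k * l, mul_mem hk hl, ?_⟩
    rw [QuotientGroup.mk_mul, QuotientGroup.mk_mul, hak, hbl, hc.mul_pow]
  inv_mem' := by
    rintro a ⟨k, hk, hak⟩
    refine ⟨k⁻¹, inv_mem hk, ?_⟩
    rw [QuotientGroup.mk_inv, QuotientGroup.mk_inv, hak, inv_pow]

instance (φ : G →* R) (p : ℕ) (M : Subgroup G) [M.Normal]
    (hM : ⁅φ.ker, (⊤ : Subgroup G)⁆ ≤ M) : (powKernel φ p M hM).Normal where
  conj_mem := by
    rintro a ⟨k, hk, hak⟩ g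
    refine ⟨g * k * g⁻¹, Subgroup.Normal.conj_mem inferInstance k hk g, ?_⟩
    simp only [QuotientGroup.mk_mul, QuotientGroup.mk_inv, hak, conj_pow]

/-- Let `φ : G → R` be an epimorphism of `X`-groups, and `S` the preimage of the torsion subgroup.
If `S / [S, G]` is uniquely `p`-divisible, then a quotient of `G` is a power cover of `R`. -/
theorem exists_isPowerCover_quotient [Group.IsNilpotent R] [MulDistribMulAction X R]
    [MulDistribMulAction X G] (hR : IsRadicable R) {p : ℕ} {φ : G →* R}
    (hφ : Function.Surjective φ) (hφX : ∀ (x : X) (g : G), φ (x • g) = x • φ g)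
    {S : Subgroup G} [S.Normal] (hS : S = (nilTorsion R).comap φ)
    (hdiv : ∀ z ∈ S, ∃ w ∈ S, (z : G ⧸ ⁅S, (⊤ : Subgroup G)⁆) = w ^ p)
    (htf : ∀ s : G, s ^ p ∈ ⁅S, (⊤ : Subgroup G)⁆ → s ∈ ⁅S, (⊤ : Subgroup G)⁆) :
    ∃ (N : Subgroup G) (_ : N.Normal) (_ : MulDistribMulAction X (G ⧸ N)) (ψ : G ⧸ N →* R),
      IsPowerCover X p ψ := by
  set M := ⁅S, (⊤ : Subgroup G)⁆ with hMdef
  have hkerS : φ.ker ≤ S := by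
    intro k hk
    rw [hS, Subgroup.mem_comap, MonoidHom.mem_ker.1 hk]
    exact one_mem _
  have hM : ⁅φ.ker, (⊤ : Subgroup G)⁆ ≤ M := Subgroup.commutator_mono hkerS le_rfl
  have hMker : M ≤ φ.ker := by
    refine Subgroup.commutator_le.2 fun s hs g _ => ?_
    rw [MonoidHom.mem_ker, map_commutatorElement, commutatorElement_eq_one_iff_mul_comm]
    rw [hS] at hs
    exact ((Subgroup.mem_center_iff.1 (nilTorsion_le_center hR hs)) (φ g)).symm
  let N := powKernel φ p M hM
  have hMN : M ≤ N := fun m hm =>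
    ⟨1, one_mem _, by rw [QuotientGroup.mk_one, one_pow]; exact (QuotientGroup.eq_one_iff _).2 hm⟩
  have hNker : N ≤ φ.ker := by
    rintro g ⟨k, hk, hgk⟩
    have h := hMker (QuotientGroup.eq.1 hgk)
    rw [MonoidHom.mem_ker] at h hk ⊢
    rw [map_mul, map_inv, map_pow, hk, one_pow, mul_one, inv_eq_one] at h
    exact h
  have hXS : ∀ (x : X), ∀ s ∈ S, x • s ∈ S := by
    intro x s hs
    rw [hS, Subgroup.mem_comap] at hs ⊢
    rw [hφX]
    exact smul_mem_nilTorsion x hs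
  have hXM : ∀ (x : X), ∀ m ∈ M, x • m ∈ M := by
    intro x
    have h : M.map (MulDistribMulAction.toMonoidHom G x) ≤ M := by
      rw [hMdef, Subgroup.map_commutator]
      refine Subgroup.commutator_mono ?_ le_top
      rintro _ ⟨s, hs, rfl⟩
      exact hXS x s hs
    exact fun m hm => h (Subgroup.mem_map_of_mem _ hm)
  have hXN : ∀ (x : X), ∀ g ∈ N, x • g ∈ N := by
    rintro x g ⟨k, hk, hgk⟩
    refine ⟨x • k, ?_, ?_⟩
    · rw [MonoidHom.mem_ker] at hk ⊢
      rw [hφX, hk, smul_one]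
    · have h := hXM x _ (QuotientGroup.eq.1 hgk)
      rw [smul_mul', smul_inv', smul_pow'] at h
      exact QuotientGroup.eq.2 h
  -- Two lifts differ by an element of `φ.ker`. Since `s` is central modulo `M`, their `p`-th powers
  -- differ by the `p`-th power of that element, which is trivial modulo `N`.
  have hwell : ∀ s t : G, φ s = φ t → φ s ∈ nilTorsion R →
      ((s ^ p : G) : G ⧸ N) = ((t ^ p : G) : G ⧸ N) := by
    intro s t hst hs
    have hs' : s ∈ S := by rw [hS]; exact hs
    have hk : s⁻¹ * t ∈ φ.ker := by
      rw [MonoidHom.mem_ker, map_mul, map_inv, hst, inv_mul_cancel]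
    refine QuotientGroup.eq.2 ⟨s⁻¹ * t, hk, ?_⟩
    have hc : Commute (s : G ⧸ M) ((s⁻¹ * t : G) : G ⧸ M) := Subgroup.commute_mk_of_mem hs' _
    have h := hc.mul_pow p
    rw [← QuotientGroup.mk_mul, mul_inv_cancel_left] at h
    rw [QuotientGroup.mk_mul, QuotientGroup.mk_inv, QuotientGroup.mk_pow, QuotientGroup.mk_pow, h,
      inv_mul_cancel_left]
  have hcen : ∀ s ∈ S, ∀ g : G ⧸ N, Commute (s : G ⧸ N) g := by
    intro s hs g
    obtain ⟨g, rfl⟩ := QuotientGroup.mk_surjective g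
    rw [← commutatorElement_eq_one_iff_commute]
    exact (QuotientGroup.eq_one_iff (N := N) _).2
      (hMN (Subgroup.commutator_mem_commutator hs (Subgroup.mem_top g)))
  let ψ : G ⧸ N →* R := QuotientGroup.lift N φ hNker
  have hψ : ∀ g : G, ψ (g : G ⧸ N) = φ g := fun g => rfl
  have hψs : Function.Surjective ψ := fun r => by
    obtain ⟨g, rfl⟩ := hφ r
    exact ⟨g, rfl⟩
  let σ : R → G := Function.surjInv hφ
  have hσ : ∀ r, φ (σ r) = r := Function.surjInv_eq hφ
  let ν₀ : nilTorsion R →* (nilTorsion R).comap ψ := MonoidHom.mk'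
    (fun u => ⟨((σ u ^ p : G) : G ⧸ N), by
      rw [Subgroup.mem_comap, hψ, map_pow, hσ]
      exact pow_mem u.2 p⟩) (by
    intro u v
    refine Subtype.ext ?_
    have huS : σ u ∈ S := by rw [hS, Subgroup.mem_comap, hσ]; exact u.2
    change ((σ ((u * v : nilTorsion R) : R) ^ p : G) : G ⧸ N) = (σ u ^ p : G) * (σ v ^ p : G)
    rw [hwell (σ ((u * v : nilTorsion R) : R)) (σ u * σ v)
      (by rw [hσ, map_mul, hσ, hσ]; rfl) (by rw [hσ]; exact (u * v).2),
      QuotientGroup.mk_pow, QuotientGroup.mk_mul, (hcen _ huS _).mul_pow]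
    rfl)
  have hν₀ : ∀ (u : nilTorsion R) (s : G), φ s = u → (ν₀ u : G ⧸ N) = ((s ^ p : G) : G ⧸ N) := by
    intro u s hs
    exact hwell (σ u) s (by rw [hσ, hs]) (by rw [hσ]; exact u.2)
  have hinj : Function.Injective ν₀ := by
    rw [injective_iff_map_eq_one]
    intro u hu
    have h1 : ((σ u ^ p : G) : G ⧸ N) = 1 := congrArg Subtype.val hu
    obtain ⟨k, hk, hk'⟩ := (QuotientGroup.eq_one_iff _).1 h1
    have huS : σ u ∈ S := by rw [hS, Subgroup.mem_comap, hσ]; exact u.2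
    have hc : Commute (σ u : G ⧸ M) ((k⁻¹ : G) : G ⧸ M) := Subgroup.commute_mk_of_mem huS _
    -- From `σ u ^ p ≡ k ^ p` modulo `M`, uniqueness of `p`-th roots gives `σ u ≡ k`, so `u = φ k =
    -- 1`.
    have h2 : σ u * k⁻¹ ∈ M := by
      refine htf _ ((QuotientGroup.eq_one_iff _).1 ?_)
      rw [QuotientGroup.mk_pow, QuotientGroup.mk_mul, hc.mul_pow, ← QuotientGroup.mk_pow, hk',
        QuotientGroup.mk_inv, inv_pow, mul_inv_cancel]
    have h3 := MonoidHom.mem_ker.1 (hMker h2)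
    rw [map_mul, map_inv, MonoidHom.mem_ker.1 hk, hσ, inv_one, mul_one] at h3
    exact Subtype.ext h3
  have hsurj : Function.Surjective ν₀ := by
    rintro ⟨g, hg⟩
    obtain ⟨g, rfl⟩ := QuotientGroup.mk_surjective g
    have hgS : g ∈ S := by rw [hS]; exact hg
    obtain ⟨w, hw, hgw⟩ := hdiv g hgS
    rw [hS] at hw
    refine ⟨⟨φ w, hw⟩, Subtype.ext ?_⟩
    rw [hν₀ ⟨φ w, hw⟩ w rfl]
    refine QuotientGroup.eq.2 (hMN (QuotientGroup.eq.1 ?_))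
    rw [hgw, QuotientGroup.mk_pow]
  refine ⟨N, inferInstance, quotientMulDistribMulAction N hXN, ψ, ?_⟩
  let _ : MulDistribMulAction X (G ⧸ N) := quotientMulDistribMulAction N hXN
  have hsmul : ∀ (x : X) (g : G), x • (g : G ⧸ N) = ((x • g : G) : G ⧸ N) := fun _ _ => rfl
  refine ⟨?_, ?_, hψs, ?_, MulEquiv.ofBijective ν₀ ⟨hinj, hsurj⟩, ?_, ?_⟩
  -- The kernel of `ψ` is central, so the nilpotency class grows by at most one.
  · obtain ⟨n, hn⟩ := Subgroup.nilpotent_iff_lowerCentralSeries.1 ‹Group.IsNilpotent R›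
    refine Subgroup.nilpotent_iff_lowerCentralSeries.2 ⟨n + 1, ?_⟩
    rw [eq_bot_iff, Subgroup.lowerCentralSeries_succ, Subgroup.commutator_le]
    intro g hg h _
    have h1 : ψ g ∈ (⊤ : Subgroup R).lowerCentralSeries n := by
      have := Subgroup.mem_map_of_mem ψ hg
      rw [Subgroup.map_lowerCentralSeries] at this
      exact Subgroup.lowerCentralSeries_mono n le_top this
    rw [hn, Subgroup.mem_bot] at h1
    obtain ⟨g, rfl⟩ := QuotientGroup.mk_surjective g
    rw [Subgroup.mem_bot, commutatorElement_eq_one_iff_commute]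
    exact hcen g (hkerS h1) h
  -- Lift an `n`-th root of `ψ g`. The error lies in `ker ψ`, so it is the image under `ν₀` of some
  -- `w`; an `n`-th root of `w` in `R` is torsion, and its image under `ν₀` is a central correction.
  · intro n hn g
    obtain ⟨x, hx⟩ := hR n hn (ψ g)
    obtain ⟨y, rfl⟩ := hψs x
    have hk : ψ ((y ^ n)⁻¹ * g) = 1 := by rw [map_mul, map_inv, map_zpow, hx, inv_mul_cancel]
    obtain ⟨w, hw⟩ := hsurj ⟨(y ^ n)⁻¹ * g, by rw [Subgroup.mem_comap, hk]; exact one_mem _⟩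
    obtain ⟨t, ht⟩ := hR n hn w
    have ht' : t ∈ nilTorsion R := by
      have h1 : IsOfFinOrder (t ^ n) := ht ▸ w.2
      have h2 : IsOfFinOrder (t ^ n.natAbs) := by
        rcases Int.natAbs_eq n with h | h
        · rw [h, zpow_natCast] at h1
          exact h1
        · rw [h, zpow_neg, zpow_natCast] at h1
          exact isOfFinOrder_inv_iff.1 h1
      exact (isOfFinOrder_pow.1 h2).resolve_right (Int.natAbs_ne_zero.2 hn)
    refine ⟨y * (ν₀ ⟨t, ht'⟩ : G ⧸ N), ?_⟩
    have hc : Commute y (ν₀ ⟨t, ht'⟩ : G ⧸ N) := by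
      rw [hν₀ ⟨t, ht'⟩ (σ t) (hσ t)]
      refine (hcen _ ?_ y).symm
      rw [hS, Subgroup.mem_comap, map_pow, hσ]
      exact pow_mem ht' p
    have h1 : ν₀ ⟨t, ht'⟩ ^ n = ν₀ w := by
      rw [← map_zpow]
      exact congrArg ν₀ (Subtype.ext ht)
    have h2 := congrArg Subtype.val (h1.trans hw)
    rw [Subgroup.coe_zpow] at h2
    rw [hc.mul_zpow, h2, mul_inv_cancel_left]
  · intro x g
    obtain ⟨g, rfl⟩ := QuotientGroup.mk_surjective g
    rw [hsmul, hψ, hψ, hφX]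
  · intro x u
    change (ν₀ _ : G ⧸ N) = x • (ν₀ u : G ⧸ N)
    rw [hν₀ u (σ u) (hσ u), hν₀ _ (x • σ u) (by rw [hφX, hσ]), hsmul, smul_pow']
  · intro u
    change ψ (ν₀ u : G ⧸ N) = _
    rw [hν₀ u (σ u) (hσ u), hψ, map_pow, hσ]

/-- Every radicable nilpotent `X`-group has a power cover. -/
theorem IsRadicable.exists_isPowerCover {X : Type v} [Group X] {R : Type u} [Group R]
    [Group.IsNilpotent R] [MulDistribMulAction X R] (hR : IsRadicable R) {p : ℕ} (hp : p ≠ 0) :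
    ∃ (Rbar : Type u) (_ : Group Rbar) (_ : MulDistribMulAction X Rbar) (ψ : Rbar →* R),
      IsPowerCover X p ψ := by
  let _ : MulDistribMulAction X (RatFreeProduct (Multiplicative ℚ →* R)) :=
    ratFreeProductMulDistribMulAction R
  let φ : RatFreeProduct (Multiplicative ℚ →* R) →* R := Monoid.CoprodI.lift fun f => f
  have hφ : Function.Surjective φ := by
    intro r
    obtain ⟨f, hf⟩ := hR.exists_hom r
    refine ⟨Monoid.CoprodI.of (M := fun _ : Multiplicative ℚ →* R => Multiplicative ℚ) (i := f)
      (Multiplicative.ofAdd 1), ?_⟩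
    rw [← hf]
    exact Monoid.CoprodI.lift_of _ _
  have hφX : ∀ (x : X) (g : RatFreeProduct (Multiplicative ℚ →* R)), φ (x • g) = x • φ g := by
    intro x g
    suffices h : φ.comp (ratFreeProductMap x) = (MulDistribMulAction.toMonoidHom R x).comp φ from
      DFunLike.congr_fun h g
    refine Monoid.CoprodI.ext_hom _ _ fun f => ?_
    refine MonoidHom.ext fun q => ?_
    simp only [ratFreeProductMap, φ, MonoidHom.comp_apply, Monoid.CoprodI.lift_of]
  obtain ⟨n, hn⟩ := Subgroup.nilpotent_iff_lowerCentralSeries.1 ‹Group.IsNilpotent R›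
  have hker : ∀ g ∈ (⊤ : Subgroup (RatFreeProduct (Multiplicative ℚ →* R))).lowerCentralSeries n,
      φ g = 1 := by
    intro g hg
    have := Subgroup.mem_map_of_mem φ hg
    rw [Subgroup.map_lowerCentralSeries] at this
    have h : φ g ∈ (⊤ : Subgroup R).lowerCentralSeries n :=
      Subgroup.lowerCentralSeries_mono n le_top this
    rwa [hn, Subgroup.mem_bot] at h
  have : (nilTorsion R).Normal := ⟨fun u hu g => (MulAut.conj g).toMonoidHom.isOfFinOrder hu⟩
  let S := (nilTorsion R).comap φ
  have hnS : (⊤ : Subgroup (RatFreeProduct (Multiplicative ℚ →* R))).lowerCentralSeries n ≤ S := by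
    intro g hg
    rw [Subgroup.mem_comap, hker g hg]
    exact one_mem _
  have hdiv : ∀ z ∈ S, ∃ w ∈ S, (z : RatFreeProduct (Multiplicative ℚ →* R) ⧸
      ⁅S, (⊤ : Subgroup (RatFreeProduct (Multiplicative ℚ →* R)))⁆) = w ^ p := by
    intro z hz
    -- Depth `n + 1` suffices: term `n` lies in `S`, so term `n + 1` lies in `[S, F]`. The root
    -- stays in `S` because an element of `R` with a torsion `p`-th power is torsion.
    obtain ⟨a, ha⟩ := RatFreeProduct.exists_pow_inv_mul_mem_lowerCentralSeries hp (n + 1) z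
    refine ⟨a, ?_, (QuotientGroup.eq.2 (Subgroup.commutator_mono hnS le_rfl ha)).symm⟩
    have h1 := hker _ (Subgroup.lowerCentralSeries_antitone _ n.le_succ ha)
    rw [map_mul, map_inv, inv_mul_eq_one, map_pow] at h1
    have h2 : IsOfFinOrder (φ a ^ p) := h1 ▸ hz
    exact (isOfFinOrder_pow.1 h2).resolve_right hp
  obtain ⟨N, _, _, ψ, hψ⟩ := exists_isPowerCover_quotient (X := X) hR hφ hφX (S := S) rfl hdiv
    (fun s hs => RatFreeProduct.mem_commutator_of_pow_mem hp hdiv hnS hs)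
  exact ⟨_, _, _, ψ, hψ⟩

end Construction

theorem proposition3p12 {X : Type v} [Group X]
    {R : Type u} [Group R] [Group.IsNilpotent R] [MulDistribMulAction X R]
    (hR : IsRadicable R) (p : ℕ) (hp : p.Prime)
    (hP : IsPiMinimax {p} (nilTorsion R)) :
    (∃ (Rbar : Type u) (_ : Group Rbar) (_ : MulDistribMulAction X Rbar) (ψ : Rbar →* R),
      IsPowerCover X p ψ ∧ abAnnihilator X Rbar = abAnnihilator X R) ∧
    (∀ (Rbar : Type u) [Group Rbar] [MulDistribMulAction X Rbar] (ψ : Rbar →* R),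
      IsPowerCover X p ψ → abAnnihilator X Rbar = abAnnihilator X R) := by
  refine ⟨?_, fun Rbar _ _ ψ hψ => hψ.abAnnihilator_eq hp.ne_zero⟩
  obtain ⟨Rbar, hG, hA, ψ, hψ⟩ := hR.exists_isPowerCover (X := X) hp.ne_zero
  exact ⟨Rbar, hG, hA, ψ, hψ, hψ.abAnnihilator_eq hp.ne_zero⟩
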